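/- Let $p,q\ge 0$, $n=p+q$. A $(p,q)$-clan $\gamma$ is a partial matching of $\{1,\dots,n\}$ whose unmatched vertices carry signs $+$ or $-$ with $\#\{+\}-\#\{-\}=p-q$; it is *non-crossing* if there are no arcs $\{a,c\}$, $\{b,d\}$ with $a<b<c<d$. Let $u(\gamma)\in S_n$ label the $-$'s and left endpoints of arcs by $1,\dots,q$ and the $+$'s and right endpoints by $q+1,\dots,n$, each from left to right; let $v(\gamma)\in S_n$ label the $+$'s and left endpoints by $1,\dots,p$ and the $-$'s and right endpoints by $p+1,\dots,n$, each from left to right. The $\beta$-double Schubert polynomials $\mathfrak S^{(\beta)}_w(X;Y)$, $w\in S_n$, are defined by $\mathfrak S^{(\beta)}_{w_0}(X;Y)=\prod_{i+j\le n}(x_i-y_j+\beta x_iy_j)$ and $\mathfrak S^{(\beta)}_{w}=\partial^{(\beta)}_i\mathfrak S^{(\beta)}_{ws_i}$ if $w(i)<w(i+1)$, where $\partial_i^{(\beta)}f=\partial_i((1-\beta x_{i+1})f)$ and $\partial_i f=(f-f^{s_i})/(x_i-x_{i+1})$. Put $\mathfrak S_w(X;Y)=\mathfrak S_w^{(0)}(X;Y)$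 and $\mathfrak S_w(X)=\mathfrak S_w(X;0)$. Let $(w,c)$ be $(u(\gamma),q)$ or $(v(\gamma),p)$, and let $D(w)=\{(i,j): j<w(i),\ i<w^{-1}(j)\}$ be the Rothe diagram, regarded as a configuration of $+$'s in the $n\times n$ grid. ${\tt Pipe}(w)$ is the set of all configurations obtained from $D(w)$ by iterating the local moves $$\begin{matrix}\cdot&\cdot\\ \cdot&+\end{matrix}\ \mapsto\ \begin{matrix}+&\cdot\\ \cdot&\cdot\end{matrix}\qquad\text{and}\qquad \begin{matrix}\cdot&\cdot\\ \cdot&+\end{matrix}\ \mapsto\ \begin{matrix}+&\cdot\\ \cdot&+\end{matrix}$$ on consecutive rows and columns, with no $+$ in columns $c+1,\dots,n$; ${\tt Pipe}_0(w)\subseteq{\tt Pipe}(w)$ consists of those obtained with the first move only. For $\mathcal P\in{\tt Pipe}(w)$ let $${\tt wt}^{(\beta)}(\mathcal P)=(-\beta)^{\#\mathcal P-\#D(w)}\prod_{(i,j)\in\mathcal P}(x_i-y_j+\beta x_iy_j).$$ For a matchless clan $\tau$ with $p$ $+$'s and $q$ $-$'s, $\lambda(\tau)$ is the partition whose Young diagram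 lies northwest of the lattice path from the upper right to the lower left corner of a $p\times q$ rectangle whose $i$th step is down if $\tau_i=+$ and left if $\tau_i=-$, and $\vec f(\tau)=(f_1,\dots,f_p)$ with $f_i$ the position of the $i$th $+$. Let $\tau^-$ (resp. $\tau^+$) be obtained from $\gamma$ by replacing left endpoints by $-$ (resp. $+$) and right endpoints by $+$ (resp. $-$), and let a hat denote flipping all signs. Put $\lambda(\gamma)=\lambda(\tau^-)$, $\vec f(\gamma)=\vec f(\tau^-)$, $\lambda(\widehat\gamma)=\lambda(\widehat{\tau^+})$, $\vec f(\widehat\gamma)=\vec f(\widehat{\tau^+})$. A semistandard set-valued tableau of shape $\lambda$ with flagging $\vec f$ fills each box of $\lambda$ with a nonempty finite set of positive integers such that every choice of one element from each box gives a semistandard tableau, with all entries in row $r$ at most $f_r$. Its weight is $(-\beta)^{|T|-|\lambda|}\prod(x_v-y_{v+c-r}+\beta x_vy_{v+c-r})$, over all entries $v$ of all boxes $(r,c)$ (row $r$, column $c$), where $|T|$ is the number of entries. The flagged Schur polynomial is $s_{\lambda,\vec f}(X)=\sum_T\mathbf x^T$, over ordinary semistandard tableaux of shape $\lambda$ with entries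 in row $r$ at most $f_r$. **Proposition.** For every non-crossing $(p,q)$-clan $\gamma$: 1. $\mathfrak S^{(\beta)}_{u(\gamma)}(X;Y)=\sum_{\mathcal P\in{\tt Pipe}(u(\gamma))}{\tt wt}^{(\beta)}(\mathcal P)$ and $\mathfrak S^{(\beta)}_{v(\gamma)}(X;Y)=\sum_{\mathcal P\in{\tt Pipe}(v(\gamma))}{\tt wt}^{(\beta)}(\mathcal P)$. 2. There is a weight-preserving bijection between ${\tt Pipe}(u(\gamma))$ and the semistandard set-valued tableaux of shape $\lambda(\gamma)$ with flagging $\vec f(\gamma)$, and one between ${\tt Pipe}(v(\gamma))$ and those of shape $\lambda(\widehat\gamma)$ with flagging $\vec f(\widehat\gamma)$. 3. At $\beta=0$: for $w=u(\gamma)$ and $w=v(\gamma)$, $\mathfrak S_w(X;Y)=\sum_{\mathcal P\in{\tt Pipe}_0(w)}\prod_{(i,j)\in\mathcal P}(x_i-y_j)$, and there are bijections between ${\tt Pipe}_0(u(\gamma))$, ${\tt Pipe}_0(v(\gamma))$ and the ordinary flagged semistandard tableaux of these shapes and flaggings, preserving the weights $\prod_{(i,j)\in\mathcal P}(x_i-y_j)$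 and $\prod(x_v-y_{v+c-r})$ (over the boxes $(r,c)$ with entry $v$). 4. In particular $\mathfrak S_{u(\gamma)}(X)=s_{\lambda(\gamma),\vec f(\gamma)}(X)$ and $\mathfrak S_{v(\gamma)}(X)=s_{\lambda(\widehat\gamma),\vec f(\widehat\gamma)}(X)$. -/

import Mathlib

open Equiv

noncomputable section

namespace ClanSchubert

/-! Everything below is indexed from `0`: the vertices of a clan, rows, columns, tableau entries and
flags are `0, 1, 2, …` where the usual conventions have `1, 2, 3, …`. -/

/-! ### Polynomial rings -/

/-- `ℤ[β][x₀, x₁, …; y₀, y₁, …]`; `Sum.inl i` indexes `xᵢ` and `Sum.inr j` indexes `yⱼ`. -/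
abbrev BetaPoly : Type := MvPolynomial (ℕ ⊕ ℕ) (Polynomial ℤ)

/-- The variable `xᵢ`. -/
def x (i : ℕ) : BetaPoly := MvPolynomial.X (Sum.inl i)

/-- The variable `yⱼ`. -/
def y (j : ℕ) : BetaPoly := MvPolynomial.X (Sum.inr j)

/-- The deformation parameter `β`. -/
def β : BetaPoly := MvPolynomial.C Polynomial.X

/-- `f ↦ f^{sᵢ}`: exchange `xᵢ` and `xᵢ₊₁`. -/
def swapX (i : ℕ) : BetaPoly →ₐ[Polynomial ℤ] BetaPoly :=
  MvPolynomial.rename (Equiv.swap (Sum.inl i) (Sum.inl (i + 1)))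

theorem swapX_x_left (i : ℕ) : swapX i (x i) = x (i + 1) := by
  simp [swapX, x]

theorem swapX_x_right (i : ℕ) : swapX i (x (i + 1)) = x i := by
  simp [swapX, x]

theorem swapX_x_of_ne {i k : ℕ} (h : k ≠ i) (h' : k ≠ i + 1) : swapX i (x k) = x k := by
  simp [swapX, x, Equiv.swap_apply_of_ne_of_ne, h, h']

theorem swapX_beta (i : ℕ) : swapX i β = β := by
  simp [swapX, β]

theorem swapX_swapX (i : ℕ) (f : BetaPoly) : swapX i (swapX i f) = f := by
  have : ((Equiv.swap (Sum.inl i : ℕ ⊕ ℕ) (Sum.inl (i + 1))) ∘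
      (Equiv.swap (Sum.inl i : ℕ ⊕ ℕ) (Sum.inl (i + 1)))) = id := by
    funext k; simp
  simp [swapX, MvPolynomial.rename_rename, this]

theorem swapX_comm {i j : ℕ} (h : i + 1 < j) (f : BetaPoly) :
    swapX i (swapX j f) = swapX j (swapX i f) := by
  have : ((Equiv.swap (Sum.inl i : ℕ ⊕ ℕ) (Sum.inl (i + 1))) ∘
      (Equiv.swap (Sum.inl j : ℕ ⊕ ℕ) (Sum.inl (j + 1)))) =
      ((Equiv.swap (Sum.inl j : ℕ ⊕ ℕ) (Sum.inl (j + 1))) ∘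
      (Equiv.swap (Sum.inl i : ℕ ⊕ ℕ) (Sum.inl (i + 1)))) := by
    funext k
    simp only [Function.comp, Equiv.swap_apply_def]
    grind
  simp [swapX, MvPolynomial.rename_rename, this]

theorem swapX_braid (i : ℕ) (f : BetaPoly) :
    swapX i (swapX (i + 1) (swapX i f)) = swapX (i + 1) (swapX i (swapX (i + 1) f)) := by
  have : ((Equiv.swap (Sum.inl i : ℕ ⊕ ℕ) (Sum.inl (i + 1))) ∘
      (Equiv.swap (Sum.inl (i + 1) : ℕ ⊕ ℕ) (Sum.inl (i + 1 + 1)))) ∘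
      (Equiv.swap (Sum.inl i : ℕ ⊕ ℕ) (Sum.inl (i + 1))) =
      ((Equiv.swap (Sum.inl (i + 1) : ℕ ⊕ ℕ) (Sum.inl (i + 1 + 1))) ∘
      (Equiv.swap (Sum.inl i : ℕ ⊕ ℕ) (Sum.inl (i + 1)))) ∘
      (Equiv.swap (Sum.inl (i + 1) : ℕ ⊕ ℕ) (Sum.inl (i + 1 + 1))) := by
    funext k
    simp only [Function.comp, Equiv.swap_apply_def]
    grind
  simp only [swapX, MvPolynomial.rename_rename]
  rw [← Function.comp_assoc, this, ← Function.comp_assoc]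

theorem x_injective : Function.Injective x := fun i j h => by
  simpa using MvPolynomial.X_injective h

theorem x_sub_x_ne_zero {i j : ℕ} (h : i ≠ j) : x i - x j ≠ 0 := fun h0 =>
  h (x_injective (sub_eq_zero.mp h0))

/-! ### Divided differences -/

theorem exists_divDiff (i : ℕ) (f : BetaPoly) :
    ∃ g : BetaPoly, (x i - x (i + 1)) * g = f - swapX i f := by
  induction f using MvPolynomial.induction_on with
  | C a => exact ⟨0, by simp [swapX]⟩
  | add p r hp hr =>
    obtain ⟨g, hg⟩ := hp
    obtain ⟨g', hg'⟩ := hr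
    exact ⟨g + g', by rw [map_add]; linear_combination hg + hg'⟩
  | mul_X p k hp =>
    obtain ⟨g, hg⟩ := hp
    have key : ∃ e : BetaPoly, (x i - x (i + 1)) * e =
        MvPolynomial.X k - swapX i (MvPolynomial.X k) := by
      by_cases h1 : k = Sum.inl i
      · subst h1
        exact ⟨1, by have := swapX_x_left i; simp only [x] at this ⊢; rw [this]; ring⟩
      by_cases h2 : k = Sum.inl (i + 1)
      · subst h2
        exact ⟨-1, by have := swapX_x_right i; simp only [x] at this ⊢; rw [this]; ring⟩
      · exact ⟨0, by simp [swapX, Equiv.swap_apply_of_ne_of_ne h1 h2]⟩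
    obtain ⟨e, he⟩ := key
    refine ⟨g * MvPolynomial.X k + swapX i p * e, ?_⟩
    rw [map_mul]
    linear_combination MvPolynomial.X k * hg + swapX i p * he

/-- The divided difference `∂ᵢ f = (f - f^{sᵢ}) / (xᵢ - xᵢ₊₁)`. -/
def divDiff (i : ℕ) (f : BetaPoly) : BetaPoly := (exists_divDiff i f).choose

theorem divDiff_spec (i : ℕ) (f : BetaPoly) :
    (x i - x (i + 1)) * divDiff i f = f - swapX i f := (exists_divDiff i f).choose_spec

/-- The deformed divided difference `∂ᵢ^(β) f = ∂ᵢ ((1 - β xᵢ₊₁) f)`. -/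
def betaDivDiff (i : ℕ) (f : BetaPoly) : BetaPoly := divDiff i ((1 - β * x (i + 1)) * f)

theorem betaDivDiff_spec (i : ℕ) (f : BetaPoly) :
    (x i - x (i + 1)) * betaDivDiff i f =
      (1 - β * x (i + 1)) * f - (1 - β * x i) * swapX i f := by
  rw [betaDivDiff, divDiff_spec]
  simp [swapX_x_right, swapX_beta]

theorem betaDivDiff_comm {i j : ℕ} (h : i + 1 < j) (f : BetaPoly) :
    betaDivDiff i (betaDivDiff j f) = betaDivDiff j (betaDivDiff i f) := by
  have e1 := betaDivDiff_spec i (betaDivDiff j f)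
  have e2 := betaDivDiff_spec j f
  have e3 := congrArg (swapX i) e2
  have e4 := betaDivDiff_spec j (betaDivDiff i f)
  have e5 := betaDivDiff_spec i f
  have e6 := congrArg (swapX j) e5
  simp only [map_mul, map_sub, map_one, swapX_beta,
    swapX_x_of_ne (show j ≠ i by omega) (show j ≠ i + 1 by omega),
    swapX_x_of_ne (show j + 1 ≠ i by omega) (show j + 1 ≠ i + 1 by omega)] at e3
  simp only [map_mul, map_sub, map_one, swapX_beta,
    swapX_x_of_ne (show i ≠ j by omega) (show i ≠ j + 1 by omega),
    swapX_x_of_ne (show i + 1 ≠ j by omega) (show i + 1 ≠ j + 1 by omega)] at e6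
  rw [swapX_comm h] at e3
  apply mul_left_cancel₀ (mul_ne_zero (x_sub_x_ne_zero (show i ≠ i + 1 by omega))
    (x_sub_x_ne_zero (show j ≠ j + 1 by omega)))
  linear_combination (x j - x (j + 1)) * e1 + (1 - β * x (i + 1)) * e2 - (1 - β * x i) * e3
    - (x i - x (i + 1)) * e4 - (1 - β * x (j + 1)) * e5 + (1 - β * x j) * e6

theorem betaDivDiff_braid (i : ℕ) (f : BetaPoly) :
    betaDivDiff i (betaDivDiff (i + 1) (betaDivDiff i f)) =
      betaDivDiff (i + 1) (betaDivDiff i (betaDivDiff (i + 1) f)) := by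
  have n1 : swapX i (x (i + 1 + 1)) = x (i + 1 + 1) :=
    swapX_x_of_ne (by omega) (by omega)
  have n2 : swapX (i + 1) (x i) = x i := swapX_x_of_ne (by omega) (by omega)
  -- the left side
  have a3 := betaDivDiff_spec i (betaDivDiff (i + 1) (betaDivDiff i f))
  have a2 := betaDivDiff_spec (i + 1) (betaDivDiff i f)
  have a2s := congrArg (swapX i) a2
  have a1 := betaDivDiff_spec i f
  have a1s := congrArg (swapX i) a1
  have a1t := congrArg (swapX (i + 1)) a1
  have a1st := congrArg (swapX i) a1t
  -- the right side
  have b3 := betaDivDiff_spec (i + 1) (betaDivDiff i (betaDivDiff (i + 1) f))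
  have b2 := betaDivDiff_spec i (betaDivDiff (i + 1) f)
  have b2s := congrArg (swapX (i + 1)) b2
  have b1 := betaDivDiff_spec (i + 1) f
  have b1s := congrArg (swapX (i + 1)) b1
  have b1t := congrArg (swapX i) b1
  have b1st := congrArg (swapX (i + 1)) b1t
  have br := swapX_braid i f
  simp only [map_mul, map_sub, map_one, swapX_beta, swapX_x_left, swapX_x_right, n1, n2,
    swapX_swapX] at a3 a2 a2s a1 a1s a1t a1st b3 b2 b2s b1 b1s b1t b1st
  rw [br] at a1st
  generalize swapX (i + 1) (swapX i (swapX (i + 1) f)) = z at *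
  have hab := x_sub_x_ne_zero (show i ≠ i + 1 by omega)
  have hbc := x_sub_x_ne_zero (show i + 1 ≠ i + 1 + 1 by omega)
  have hac := x_sub_x_ne_zero (show i ≠ i + 1 + 1 by omega)
  generalize x i = a at *
  generalize x (i + 1) = b at *
  generalize x (i + 1 + 1) = c at *
  apply mul_left_cancel₀ (mul_ne_zero (mul_ne_zero (pow_ne_zero 2 hab) (pow_ne_zero 2 hbc))
    (pow_ne_zero 2 hac))
  linear_combination (a - b) * (b - c) ^ 2 * (a - c) ^ 2 * a3
    + (1 - β * b) * (a - b) * (b - c) * (a - c) ^ 2 * a2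
    - (1 - β * a) * (a - b) * (b - c) ^ 2 * (a - c) * a2s
    + (1 - β * b) * (1 - β * c) * (b - c) * (a - c) ^ 2 * a1
    - (1 - β * b) ^ 2 * (a - b) * (b - c) * (a - c) * a1t
    + (1 - β * a) * (1 - β * c) * (b - c) ^ 2 * (a - c) * a1s
    + (1 - β * a) ^ 2 * (a - b) * (b - c) * (a - c) * a1st
    - (a - b) ^ 2 * (b - c) * (a - c) ^ 2 * b3
    - (1 - β * c) * (a - b) * (b - c) * (a - c) ^ 2 * b2
    + (1 - β * b) * (a - b) ^ 2 * (b - c) * (a - c) * b2s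
    - (1 - β * c) * (1 - β * b) * (a - b) * (a - c) ^ 2 * b1
    + (1 - β * c) * (1 - β * a) * (a - b) * (b - c) * (a - c) * b1t
    - (1 - β * b) * (1 - β * c) * (a - b) ^ 2 * (a - c) * b1s
    - (1 - β * b) * (1 - β * a) * (a - b) * (b - c) * (a - c) * b1st

/-! ### β-double Schubert polynomials -/

/-- `w(i) < w(i + 1)`, for a position `i` such that `i` and `i + 1` are both positions of `w`. -/
def IsAscent {n : ℕ} (w : Perm (Fin n)) (i : ℕ) : Prop :=
  ∃ h : i + 1 < n, w ⟨i, by omega⟩ < w ⟨i + 1, h⟩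

/-- The simple transposition `sᵢ` of `i` and `i + 1` (the identity if these are not positions). -/
def simpleRefl (n i : ℕ) : Perm (Fin n) :=
  if h : i + 1 < n then Equiv.swap ⟨i, by omega⟩ ⟨i + 1, h⟩ else 1

/-- A measure that drops when an ascent of `w` is turned into a descent. -/
def weightedSum {n : ℕ} (w : Perm (Fin n)) : ℕ := ∑ k : Fin n, (k : ℕ) * (w k : ℕ)

theorem weightedSum_lt {n : ℕ} {w : Perm (Fin n)} {i : ℕ} (hi : IsAscent w i) :
    weightedSum (w * simpleRefl n i) < weightedSum w := by
  obtain ⟨h, hw⟩ := hi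
  set a : Fin n := ⟨i, by omega⟩ with ha
  set b : Fin n := ⟨i + 1, h⟩ with hb
  have hab : a ≠ b := by simp [ha, hb]
  have hs : simpleRefl n i = Equiv.swap a b := by simp [simpleRefl, h, ha, hb]
  have split : ∀ g : Fin n → ℕ, ∑ k, g k = g a + g b + ∑ k ∈ (Finset.univ.erase a).erase b, g k := by
    intro g
    rw [← Finset.add_sum_erase _ g (Finset.mem_univ a),
      ← Finset.add_sum_erase _ g (Finset.mem_erase.mpr ⟨hab.symm, Finset.mem_univ b⟩), add_assoc]
  unfold weightedSum
  rw [split, split, hs]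
  have rest : ∑ k ∈ (Finset.univ.erase a).erase b, (k : ℕ) * ((w * Equiv.swap a b) k : ℕ) =
      ∑ k ∈ (Finset.univ.erase a).erase b, (k : ℕ) * (w k : ℕ) := by
    refine Finset.sum_congr rfl fun k hk => ?_
    simp only [Finset.mem_erase] at hk
    rw [Perm.mul_apply, Equiv.swap_apply_of_ne_of_ne hk.2.1 hk.1]
  rw [rest]
  simp only [Perm.mul_apply, Equiv.swap_apply_left, Equiv.swap_apply_right]
  have hlt : (w a : ℕ) < w b := hw
  have : (b : ℕ) = a + 1 := rfl
  rw [this]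
  nlinarith

open Classical in
/-- The β-double Schubert polynomial of `w`: for the longest element (the only `w` without ascents)
it is `∏_{i + j ≤ n} (xᵢ - yⱼ + β xᵢ yⱼ)` (with `i, j ≥ 1`), and for every ascent `i` of `w` it is
`∂ᵢ^(β)` of that of `w sᵢ`. The definition picks one ascent; `betaSchubert_of_isAscent` shows that
every other choice gives the same. -/
def betaSchubert {n : ℕ} (w : Perm (Fin n)) : BetaPoly :=
  if h : ∃ i, IsAscent w i then
    betaDivDiff h.choose (betaSchubert (w * simpleRefl n h.choose))
  else
    ∏ ij : Fin n × Fin n with (ij.1 : ℕ) + ij.2 + 1 < n,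
      (x ij.1 - y ij.2 + β * x ij.1 * y ij.2)
termination_by weightedSum w
decreasing_by exact weightedSum_lt h.choose_spec

theorem betaSchubert_revPerm (n : ℕ) :
    betaSchubert (Fin.revPerm : Perm (Fin n)) =
      ∏ ij : Fin n × Fin n with (ij.1 : ℕ) + ij.2 + 1 < n,
        (x ij.1 - y ij.2 + β * x ij.1 * y ij.2) := by
  rw [betaSchubert, dif_neg]
  rintro ⟨i, h, hw⟩
  simp only [Fin.revPerm_apply, Fin.rev_lt_rev, Fin.mk_lt_mk] at hw
  omega

theorem simpleRefl_apply {n i : ℕ} (h : i + 1 < n) (k : Fin n) :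
    simpleRefl n i k = if (k : ℕ) = i then ⟨i + 1, h⟩ else if (k : ℕ) = i + 1 then ⟨i, by omega⟩
      else k := by
  simp [simpleRefl, h, Equiv.swap_apply_def, Fin.ext_iff]

theorem simpleRefl_comm {n i j : ℕ} (hi : i + 1 < n) (hj : j + 1 < n) (h : i + 1 < j) :
    simpleRefl n i * simpleRefl n j = simpleRefl n j * simpleRefl n i := by
  ext k
  simp only [Perm.mul_apply, simpleRefl_apply hi, simpleRefl_apply hj]
  grind

theorem simpleRefl_braid {n i : ℕ} (hi : i + 1 + 1 < n) :
    simpleRefl n i * simpleRefl n (i + 1) * simpleRefl n i =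
      simpleRefl n (i + 1) * simpleRefl n i * simpleRefl n (i + 1) := by
  ext k
  simp only [Perm.mul_apply, simpleRefl_apply hi, simpleRefl_apply (show i + 1 < n by omega)]
  grind

theorem betaSchubert_diamond {n : ℕ} (w : Perm (Fin n))
    (ih : ∀ v : Perm (Fin n), weightedSum v < weightedSum w → ∀ i, IsAscent v i →
      betaSchubert v = betaDivDiff i (betaSchubert (v * simpleRefl n i)))
    {i j : ℕ} (hij : i < j) (hi : IsAscent w i) (hj : IsAscent w j) :
    betaDivDiff i (betaSchubert (w * simpleRefl n i)) =
      betaDivDiff j (betaSchubert (w * simpleRefl n j)) := by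
  obtain ⟨hin, hiw⟩ := id hi
  obtain ⟨hjn, hjw⟩ := id hj
  rcases Nat.lt_or_ge (i + 1) j with hlt | hge
  · have n1 : j ≠ i := by omega
    have n2 : j ≠ i + 1 := by omega
    have n3 : j + 1 ≠ i := by omega
    have h1 : IsAscent (w * simpleRefl n i) j := ⟨hjn, by
      simpa [Perm.mul_apply, simpleRefl_apply hin, n1, n2, n3] using hjw⟩
    have h2 : IsAscent (w * simpleRefl n j) i := ⟨hin, by
      simpa [Perm.mul_apply, simpleRefl_apply hjn, n1.symm, n2.symm, n3.symm] using hiw⟩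
    rw [ih _ (weightedSum_lt hi) _ h1, ih _ (weightedSum_lt hj) _ h2, betaDivDiff_comm hlt,
      mul_assoc, mul_assoc, simpleRefl_comm hin hjn hlt]
  · obtain rfl : j = i + 1 := by omega
    have n1 : i + 1 + 1 ≠ i := by omega
    have n2 : i ≠ i + 1 + 1 := by omega
    have h1 : IsAscent (w * simpleRefl n i) (i + 1) := ⟨hjn, by
      simpa [Perm.mul_apply, simpleRefl_apply hin, n1, n2] using lt_trans hiw hjw⟩
    have h2 : IsAscent (w * simpleRefl n (i + 1)) i := ⟨hin, by
      simpa [Perm.mul_apply, simpleRefl_apply hjn, n1, n2] using lt_trans hiw hjw⟩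
    have h3 : IsAscent (w * simpleRefl n i * simpleRefl n (i + 1)) i := ⟨hin, by
      simpa [Perm.mul_apply, simpleRefl_apply hjn, simpleRefl_apply hin, n1, n2] using hjw⟩
    have h4 : IsAscent (w * simpleRefl n (i + 1) * simpleRefl n i) (i + 1) := ⟨hjn, by
      simpa [Perm.mul_apply, simpleRefl_apply hjn, simpleRefl_apply hin, n1, n2] using hiw⟩
    rw [ih _ (weightedSum_lt hi) _ h1, ih _ (weightedSum_lt hj) _ h2,
      ih _ ((weightedSum_lt h1).trans (weightedSum_lt hi)) _ h3,
      ih _ ((weightedSum_lt h2).trans (weightedSum_lt hj)) _ h4, betaDivDiff_braid]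
    congr 4
    have := simpleRefl_braid (n := n) hjn
    simp only [mul_assoc] at this ⊢
    rw [this]

theorem betaSchubert_of_isAscent {n : ℕ} (w : Perm (Fin n)) {i : ℕ} (hi : IsAscent w i) :
    betaSchubert w = betaDivDiff i (betaSchubert (w * simpleRefl n i)) := by
  induction hm : weightedSum w using Nat.strong_induction_on generalizing w i with
  | _ m ih =>
    subst hm
    have h : ∃ i, IsAscent w i := ⟨i, hi⟩
    have e : betaSchubert w =
        betaDivDiff h.choose (betaSchubert (w * simpleRefl n h.choose)) := by
      conv_lhs => rw [betaSchubert]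
      rw [dif_pos h]
    have ih' := fun v (hv : weightedSum v < weightedSum w) k (hk : IsAscent v k) =>
      ih _ hv v hk rfl
    rw [e]
    rcases lt_trichotomy i h.choose with hlt | heq | hgt
    · exact (betaSchubert_diamond w ih' hlt hi h.choose_spec).symm
    · rw [← heq]
    · exact betaSchubert_diamond w ih' hgt h.choose_spec hi

/-- The double Schubert polynomial: `β = 0`. -/
def doubleSchubert {n : ℕ} (w : Perm (Fin n)) : MvPolynomial (ℕ ⊕ ℕ) ℤ :=
  MvPolynomial.map (Polynomial.evalRingHom 0) (betaSchubert w)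

/-- The single Schubert polynomial: `β = 0` and all `yⱼ = 0`. -/
def singleSchubert {n : ℕ} (w : Perm (Fin n)) : MvPolynomial ℕ ℤ :=
  MvPolynomial.aeval (Sum.elim MvPolynomial.X (fun _ => 0)) (doubleSchubert w)

/-! ### Pipe diagrams -/

/-- A configuration of `+`'s in the `n × n` grid: the set of positions (row, column) of its `+`'s. -/
abbrev Config (n : ℕ) : Type := Finset (Fin n × Fin n)

/-- The Rothe diagram `D(w)`: the positions `(i, j)` with `j < w(i)` and `i < w⁻¹(j)`. -/
def rothe {n : ℕ} (w : Perm (Fin n)) : Config n :=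
  Finset.univ.filter fun ij => ij.2 < w ij.1 ∧ ij.1 < w.symm ij.2

/-- The rows `i, i'` and columns `j, j'` are consecutive, and in this `2 × 2` window of `P` there is a
`+` in the lower right corner `(i', j')` and nowhere else. -/
def IsExcitable {n : ℕ} (P : Config n) (i i' j j' : Fin n) : Prop :=
  (i' : ℕ) = i + 1 ∧ (j' : ℕ) = j + 1 ∧
    (i, j) ∉ P ∧ (i, j') ∉ P ∧ (i', j) ∉ P ∧ (i', j') ∈ P

/-- The local move that shifts the `+` of such a window from the lower right corner to the upper left
corner. -/
def Move {n : ℕ} (P P' : Config n) : Prop :=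
  ∃ i i' j j' : Fin n, IsExcitable P i i' j j' ∧ P' = insert (i, j) (P.erase (i', j'))

/-- The `K`-theoretic local move, which adds a `+` in the upper left corner of such a window and keeps
the one in the lower right corner. -/
def KMove {n : ℕ} (P P' : Config n) : Prop :=
  ∃ i i' j j' : Fin n, IsExcitable P i i' j j' ∧ P' = insert (i, j) P

/-- There is no `+` outside the first `c` columns. -/
def InColumns {n : ℕ} (c : ℕ) (P : Config n) : Prop := ∀ ij ∈ P, (ij.2 : ℕ) < c

open Classical in
/-- The pipe diagrams of `w`, with `+`'s restricted to the first `c` columns: everything obtained from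
`D(w)` by iterating both local moves. -/
def Pipe {n : ℕ} (c : ℕ) (w : Perm (Fin n)) : Finset (Config n) :=
  Finset.univ.filter fun P =>
    Relation.ReflTransGen (fun P P' => (Move P P' ∨ KMove P P') ∧ InColumns c P') (rothe w) P

open Classical in
/-- The reduced pipe diagrams: those obtained from `D(w)` by iterating `Move` only. -/
def ReducedPipe {n : ℕ} (c : ℕ) (w : Perm (Fin n)) : Finset (Config n) :=
  Finset.univ.filter fun P =>
    Relation.ReflTransGen (fun P P' => Move P P' ∧ InColumns c P') (rothe w) P

/-- The β-weight of a pipe diagram `P` of `w`: the product of `xᵢ - yⱼ + β xᵢ yⱼ` over the `+`'s of `P`,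
with a factor `-β` for every `+` of `P` in excess of the number of boxes of `D(w)`. -/
def betaWeight {n : ℕ} (w : Perm (Fin n)) (P : Config n) : BetaPoly :=
  (-β) ^ (P.card - (rothe w).card) * ∏ ij ∈ P, (x ij.1 - y ij.2 + β * x ij.1 * y ij.2)

/-- The weight at `β = 0` of a configuration: the product of `xᵢ - yⱼ` over its `+`'s. -/
def weight {n : ℕ} (P : Config n) : MvPolynomial (ℕ ⊕ ℕ) ℤ :=
  ∏ ij ∈ P, (MvPolynomial.X (Sum.inl (ij.1 : ℕ)) - MvPolynomial.X (Sum.inr (ij.2 : ℕ)))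

/-! ### Flagged tableaux and flagged Schur polynomials -/

/-- Semistandard tableaux of shape `μ` whose entries in row `i` are at most `f i`. -/
def FlaggedTableau (μ : YoungDiagram) (f : ℕ → ℕ) : Type :=
  {T : SemistandardYoungTableau μ // ∀ i j, (i, j) ∈ μ → T i j ≤ f i}

instance (μ : YoungDiagram) (f : ℕ → ℕ) : Finite (FlaggedTableau μ f) := by
  refine Finite.of_injective
    (fun T : FlaggedTableau μ f => fun c : μ.cells =>
      (⟨T.1 c.1.1 c.1.2, Nat.lt_succ_of_le (T.2 _ _ c.2)⟩ : Fin (f c.1.1 + 1))) ?_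
  intro T U h
  apply Subtype.ext
  apply SemistandardYoungTableau.ext
  intro i j
  by_cases hc : (i, j) ∈ μ
  · have := congrFun h ⟨(i, j), hc⟩
    simpa using this
  · rw [T.1.zeros hc, U.1.zeros hc]

instance (μ : YoungDiagram) (f : ℕ → ℕ) : Fintype (FlaggedTableau μ f) := Fintype.ofFinite _

/-- The flagged Schur polynomial `s_{μ, f}(X) = ∑_T x^T`, summed over the flagged tableaux `T`. -/
def flaggedSchur (μ : YoungDiagram) (f : ℕ → ℕ) : MvPolynomial ℕ ℤ :=
  ∑ T : FlaggedTableau μ f, ∏ c ∈ μ.cells, MvPolynomial.X (T.1 c.1 c.2)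

/-- The double weight of a flagged tableau: the product, over the boxes `(r, c)` with entry `v`,
of `x_v - y_{v + c - r}`. (Here `r ≤ v` by column strictness.) -/
def FlaggedTableau.weight {μ : YoungDiagram} {f : ℕ → ℕ} (T : FlaggedTableau μ f) :
    MvPolynomial (ℕ ⊕ ℕ) ℤ :=
  ∏ c ∈ μ.cells, (MvPolynomial.X (Sum.inl (T.1 c.1 c.2)) -
    MvPolynomial.X (Sum.inr (T.1 c.1 c.2 + c.2 - c.1)))

/-- Semistandard set-valued tableaux of shape `μ` whose entries in row `i` are at most `f i`: every box
holds a nonempty finite set, and picking one element from every box always gives a filling that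
increases weakly along rows and strictly down columns. -/
@[ext] structure FlaggedSetTableau (μ : YoungDiagram) (f : ℕ → ℕ) where
  entry : ℕ → ℕ → Finset ℕ
  entry_eq_empty : ∀ i j, (i, j) ∉ μ → entry i j = ∅
  entry_nonempty : ∀ i j, (i, j) ∈ μ → (entry i j).Nonempty
  row_weak : ∀ i j₁ j₂, j₁ < j₂ → ∀ a ∈ entry i j₁, ∀ b ∈ entry i j₂, a ≤ b
  col_strict : ∀ i₁ i₂ j, i₁ < i₂ → ∀ a ∈ entry i₁ j, ∀ b ∈ entry i₂ j, a < b
  flagged : ∀ i j, ∀ a ∈ entry i j, a ≤ f i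

/-- The double β-weight of a flagged set-valued tableau: the product of
`x_v - y_{v + c - r} + β x_v y_{v + c - r}` over all entries `v` of all boxes `(r, c)`, with a factor
`-β` for every entry in excess of the number of boxes. -/
def FlaggedSetTableau.betaWeight {μ : YoungDiagram} {f : ℕ → ℕ} (T : FlaggedSetTableau μ f) :
    BetaPoly :=
  (-β) ^ ((∑ c ∈ μ.cells, (T.entry c.1 c.2).card) - μ.card) *
    ∏ c ∈ μ.cells, ∏ v ∈ T.entry c.1 c.2,
      (x v - y (v + c.2 - c.1) + β * x v * y (v + c.2 - c.1))

/-! ### Clans -/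

/-- A `(p, q)`-clan on `n = p + q` vertices: a partial matching (`mate i` is the vertex matched with
`i`, and `mate i = i` if `i` is unmatched) together with a sign `+` or `-` on every unmatched vertex,
such that `#plus - #minus = p - q`. -/
structure Clan (n p q : ℕ) where
  mate : Fin n → Fin n
  mate_mate : ∀ i, mate (mate i) = i
  plus : Finset (Fin n)
  minus : Finset (Fin n)
  disjoint : Disjoint plus minus
  signed_iff : ∀ i, (i ∈ plus ∨ i ∈ minus) ↔ mate i = i
  size_eq : p + q = n
  sign_diff : (plus.card : ℤ) - minus.card = (p : ℤ) - q

namespace Clan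

variable {n p q : ℕ}

/-- No two arcs cross. -/
def NonCrossing (γ : Clan n p q) : Prop :=
  ¬ ∃ i j : Fin n, i < j ∧ j < γ.mate i ∧ γ.mate i < γ.mate j

/-- The left endpoints of the arcs. -/
def left (γ : Clan n p q) : Finset (Fin n) := Finset.univ.filter fun i => i < γ.mate i

/-- The right endpoints of the arcs. -/
def right (γ : Clan n p q) : Finset (Fin n) := Finset.univ.filter fun i => γ.mate i < i

theorem card_left_eq_card_right (γ : Clan n p q) : γ.left.card = γ.right.card := by
  refine Finset.card_bij (fun i _ => γ.mate i) ?_ ?_ ?_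
  · intro i hi
    simpa [left, right, γ.mate_mate] using hi
  · intro i _ j _ h
    rw [← γ.mate_mate i, h, γ.mate_mate]
  · intro j hj
    exact ⟨γ.mate j, by simpa [left, right, γ.mate_mate] using hj, γ.mate_mate j⟩

theorem mem_cases (γ : Clan n p q) (i : Fin n) :
    (i ∈ γ.plus ∧ i ∉ γ.minus ∧ i ∉ γ.left ∧ i ∉ γ.right) ∨
    (i ∉ γ.plus ∧ i ∈ γ.minus ∧ i ∉ γ.left ∧ i ∉ γ.right) ∨
    (i ∉ γ.plus ∧ i ∉ γ.minus ∧ i ∈ γ.left ∧ i ∉ γ.right) ∨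
    (i ∉ γ.plus ∧ i ∉ γ.minus ∧ i ∉ γ.left ∧ i ∈ γ.right) := by
  have h := γ.signed_iff i
  have hd : i ∈ γ.plus → i ∉ γ.minus := fun h => Finset.disjoint_left.mp γ.disjoint h
  simp only [left, right, Finset.mem_filter, Finset.mem_univ, true_and]
  rcases lt_trichotomy i (γ.mate i) with h' | h' | h'
  · have : γ.mate i ≠ i := h'.ne'
    have := h'.not_gt
    tauto
  · have h1 : ¬ i < γ.mate i := h'.not_lt
    have h2 : ¬ γ.mate i < i := h'.not_gt
    have := h'.symm
    tauto
  · have : γ.mate i ≠ i := h'.ne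
    have := h'.not_gt
    tauto

theorem card_total (γ : Clan n p q) :
    γ.plus.card + γ.minus.card + γ.left.card + γ.right.card = n := by
  classical
  have d1 : Disjoint γ.plus γ.minus := γ.disjoint
  have d2 : Disjoint (γ.plus ∪ γ.minus) γ.left := by
    rw [Finset.disjoint_left]; intro i; have := γ.mem_cases i; simp only [Finset.mem_union]; tauto
  have d3 : Disjoint (γ.plus ∪ γ.minus ∪ γ.left) γ.right := by
    rw [Finset.disjoint_left]; intro i; have := γ.mem_cases i; simp only [Finset.mem_union]; tauto
  rw [← Finset.card_union_of_disjoint d1, ← Finset.card_union_of_disjoint d2,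
    ← Finset.card_union_of_disjoint d3]
  have : γ.plus ∪ γ.minus ∪ γ.left ∪ γ.right = Finset.univ := by
    ext i; have := γ.mem_cases i; simp only [Finset.mem_union, Finset.mem_univ]; tauto
  rw [this, Finset.card_univ, Fintype.card_fin]

/-- The label of position `i`: the elements of `A` get the labels `0, …, #A - 1` from left to right, and
the other positions get the labels `#A, #A + 1, …` from left to right. -/
def label (A : Finset (Fin n)) (i : Fin n) : ℕ :=
  if i ∈ A then (A.filter (· < i)).card else A.card + (Aᶜ.filter (· < i)).card

theorem card_filter_lt {A : Finset (Fin n)} {i : Fin n} (hi : i ∈ A) :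
    (A.filter (· < i)).card < A.card :=
  Finset.card_lt_card (Finset.filter_ssubset.mpr ⟨i, hi, lt_irrefl i⟩)

theorem card_filter_lt_lt {A : Finset (Fin n)} {i j : Fin n} (hi : i ∈ A) (hij : i < j) :
    (A.filter (· < i)).card < (A.filter (· < j)).card := by
  refine Finset.card_lt_card ⟨?_, ?_⟩
  · intro k hk
    simp only [Finset.mem_filter] at hk ⊢
    exact ⟨hk.1, hk.2.trans hij⟩
  · intro h
    have := h (Finset.mem_filter.mpr ⟨hi, hij⟩)
    simp at this

theorem label_lt (A : Finset (Fin n)) (i : Fin n) : label A i < n := by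
  have h1 : A.card + Aᶜ.card = n := by simp [Finset.card_add_card_compl]
  unfold label
  split_ifs with hi
  · have := card_filter_lt hi
    omega
  · have := card_filter_lt (Finset.mem_compl.mpr hi)
    omega

theorem label_injective (A : Finset (Fin n)) : Function.Injective (label A) := by
  intro i j h
  unfold label at h
  split_ifs at h with hi hj hj
  · rcases lt_trichotomy i j with h' | h' | h'
    · have := card_filter_lt_lt hi h'; omega
    · exact h'
    · have := card_filter_lt_lt hj h'; omega
  · have := card_filter_lt hi; omega
  · have := card_filter_lt hj; omega
  · rcases lt_trichotomy i j with h' | h' | h'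
    · have := card_filter_lt_lt (Finset.mem_compl.mpr hi) h'; omega
    · exact h'
    · have := card_filter_lt_lt (Finset.mem_compl.mpr hj) h'; omega

/-- The permutation `i ↦ label A i`. -/
def shuffle (A : Finset (Fin n)) : Perm (Fin n) :=
  Equiv.ofBijective (fun i => ⟨label A i, label_lt A i⟩)
    (Finite.injective_iff_bijective.mp fun _ _ h => label_injective A (Fin.mk.inj_iff.mp h))

/-- `u(γ)`: the `-`'s and left endpoints get the labels `1, …, q` and the `+`'s and right endpoints the
labels `q + 1, …, n`, both from left to right. -/
def u (γ : Clan n p q) : Perm (Fin n) := shuffle (γ.minus ∪ γ.left)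

/-- `v(γ)`: the `+`'s and left endpoints get the labels `1, …, p` and the `-`'s and right endpoints the
labels `p + 1, …, n`, both from left to right. -/
def v (γ : Clan n p q) : Perm (Fin n) := shuffle (γ.plus ∪ γ.left)

theorem card_minus_union_left (γ : Clan n p q) : (γ.minus ∪ γ.left).card = q := by
  rw [Finset.card_union_of_disjoint]
  · have := γ.card_total; have := γ.card_left_eq_card_right; have := γ.sign_diff
    have := γ.size_eq
    omega
  · rw [Finset.disjoint_left]; intro i; have := γ.mem_cases i; tauto

theorem card_plus_union_left (γ : Clan n p q) : (γ.plus ∪ γ.left).card = p := by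
  rw [Finset.card_union_of_disjoint]
  · have := γ.card_total; have := γ.card_left_eq_card_right; have := γ.sign_diff
    have := γ.size_eq
    omega
  · rw [Finset.disjoint_left]; intro i; have := γ.mem_cases i; tauto

/-- The matchless clan `τ⁻`: every left endpoint becomes a `-` and every right endpoint a `+`. -/
def tauMinus (γ : Clan n p q) : Clan n p q where
  mate := id
  mate_mate _ := rfl
  plus := γ.plus ∪ γ.right
  minus := γ.minus ∪ γ.left
  disjoint := by
    rw [Finset.disjoint_left]; intro i; have := γ.mem_cases i; simp only [Finset.mem_union]; tauto
  signed_iff i := by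
    have := γ.mem_cases i; simp only [Finset.mem_union, id]; tauto
  size_eq := γ.size_eq
  sign_diff := by
    have d1 : Disjoint γ.plus γ.right := by
      rw [Finset.disjoint_left]; intro i; have := γ.mem_cases i; tauto
    have d2 : Disjoint γ.minus γ.left := by
      rw [Finset.disjoint_left]; intro i; have := γ.mem_cases i; tauto
    rw [Finset.card_union_of_disjoint d1, Finset.card_union_of_disjoint d2]
    have := γ.sign_diff; have := γ.card_left_eq_card_right
    omega

/-- The matchless clan `τ⁺`: every left endpoint becomes a `+` and every right endpoint a `-`. -/
def tauPlus (γ : Clan n p q) : Clan n p q where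
  mate := id
  mate_mate _ := rfl
  plus := γ.plus ∪ γ.left
  minus := γ.minus ∪ γ.right
  disjoint := by
    rw [Finset.disjoint_left]; intro i; have := γ.mem_cases i; simp only [Finset.mem_union]; tauto
  signed_iff i := by
    have := γ.mem_cases i; simp only [Finset.mem_union, id]; tauto
  size_eq := γ.size_eq
  sign_diff := by
    have d1 : Disjoint γ.plus γ.left := by
      rw [Finset.disjoint_left]; intro i; have := γ.mem_cases i; tauto
    have d2 : Disjoint γ.minus γ.right := by
      rw [Finset.disjoint_left]; intro i; have := γ.mem_cases i; tauto
    rw [Finset.card_union_of_disjoint d1, Finset.card_union_of_disjoint d2]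
    have := γ.sign_diff; have := γ.card_left_eq_card_right
    omega

/-- Flip all signs. -/
def flip (τ : Clan n p q) : Clan n q p where
  mate := τ.mate
  mate_mate := τ.mate_mate
  plus := τ.minus
  minus := τ.plus
  disjoint := τ.disjoint.symm
  signed_iff i := or_comm.trans (τ.signed_iff i)
  size_eq := by have := τ.size_eq; omega
  sign_diff := by have := τ.sign_diff; omega

/-- The flagging of a matchless clan: `plusFlag τ r` is the position of the `r`-th `+`. -/
def plusFlag (τ : Clan n p q) (r : ℕ) : ℕ :=
  if h : r < τ.plus.card then (τ.plus.orderEmbOfFin rfl ⟨r, h⟩ : Fin n) else 0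

theorem plusFlag_mono (τ : Clan n p q) {r s : ℕ} (hrs : r ≤ s) (hs : s < τ.plus.card) :
    τ.plusFlag r ≤ τ.plusFlag s := by
  simp only [plusFlag, dif_pos hs, dif_pos (lt_of_le_of_lt hrs hs)]
  exact (τ.plus.orderEmbOfFin rfl).monotone
    (show (⟨r, lt_of_le_of_lt hrs hs⟩ : Fin τ.plus.card) ≤ ⟨s, hs⟩ from hrs)

/-- The partition of a matchless clan (for which `τ.plus` has `p` elements): go from the upper right to
the lower left corner of a `p × q` rectangle, down at every `+` and left at every `-`, and take the
boxes northwest of this path. The `r`-th row is traversed by the `r`-th `+`, in column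
`q - #{-'s before it}`. -/
def plusShape (τ : Clan n p q) : YoungDiagram where
  cells := (Finset.range τ.plus.card ×ˢ Finset.range q).filter fun rc =>
    rc.2 < q - (τ.minus.filter fun j : Fin n => (j : ℕ) < τ.plusFlag rc.1).card
  isLowerSet := by
    rintro ⟨r, c⟩ ⟨r', c'⟩ hle hc
    obtain ⟨hr, hc'⟩ := Prod.mk_le_mk.mp hle
    simp only [Finset.coe_filter, Set.mem_ofPred_eq, Finset.mem_product, Finset.mem_range] at hc ⊢
    have hmono := τ.plusFlag_mono hr hc.1.1
    have : (τ.minus.filter fun j : Fin n => (j : ℕ) < τ.plusFlag r').card ≤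
        (τ.minus.filter fun j : Fin n => (j : ℕ) < τ.plusFlag r).card := by
      refine Finset.card_le_card fun k hk => ?_
      simp only [Finset.mem_filter] at hk ⊢
      exact ⟨hk.1, hk.2.trans_le hmono⟩
    omega

/-- `λ(γ) = λ(τ⁻)`. -/
def shape (γ : Clan n p q) : YoungDiagram := γ.tauMinus.plusShape

/-- `f(γ) = f(τ⁻)`. -/
def flag (γ : Clan n p q) : ℕ → ℕ := γ.tauMinus.plusFlag

/-- `λ(γ̂)`, the partition of `τ⁺` with all signs flipped. -/
def shapeHat (γ : Clan n p q) : YoungDiagram := γ.tauPlus.flip.plusShape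

/-- `f(γ̂)`, the flagging of `τ⁺` with all signs flipped. -/
def flagHat (γ : Clan n p q) : ℕ → ℕ := γ.tauPlus.flip.plusFlag

end Clan

end ClanSchubert

end

noncomputable section

namespace ClanSchubert

/-! ### Rothe diagrams and dominant permutations -/

theorem simpleRefl_simpleRefl (n i : ℕ) (k : Fin n) : simpleRefl n i (simpleRefl n i k) = k := by
  unfold simpleRefl; split_ifs <;> simp

theorem simpleRefl_symm (n i : ℕ) : (simpleRefl n i).symm = simpleRefl n i := by
  ext k; rw [(Equiv.symm_apply_eq _).mpr (simpleRefl_simpleRefl n i k).symm]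

theorem mem_rothe {n : ℕ} {w : Perm (Fin n)} {k m : Fin n} :
    (k, w m) ∈ rothe w ↔ w m < w k ∧ k < m := by
  simp [rothe]

theorem rothe_mul_simpleRefl {n i : ℕ} {w : Perm (Fin n)} (h : i + 1 < n)
    (hw : w ⟨i, by omega⟩ < w ⟨i + 1, h⟩) :
    rothe (w * simpleRefl n i) = insert (⟨i, by omega⟩, w ⟨i, by omega⟩)
      ((rothe w).map ((simpleRefl n i).prodCongr (Equiv.refl _)).toEmbedding) := by
  ext ⟨k, j⟩
  obtain ⟨m, rfl⟩ := w.surjective j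
  rw [Finset.mem_insert, Finset.mem_map_equiv]
  have e : w m = (w * simpleRefl n i) (simpleRefl n i m) := by
    simp [simpleRefl_simpleRefl]
  have e1 : ((simpleRefl n i).prodCongr (Equiv.refl (Fin n))).symm (k, w m) =
      (simpleRefl n i k, w m) := by
    simp [simpleRefl_symm]
  rw [e1, mem_rothe, e, mem_rothe, ← e, Perm.mul_apply, Prod.mk.injEq, w.injective.eq_iff]
  simp only [simpleRefl_apply h]
  have hne : ∀ a b : Fin n, (a : ℕ) = b → w a = w b := fun a b hab => by rw [Fin.ext hab]
  have hk := hne k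
  have hm := hne m
  by_cases k1 : (k : ℕ) = i <;> by_cases k2 : (k : ℕ) = i + 1 <;>
    by_cases m1 : (m : ℕ) = i <;> by_cases m2 : (m : ℕ) = i + 1 <;>
    simp only [k1, k2, m1, m2, if_true, if_false, Fin.lt_def, Fin.ext_iff] <;> first | omega | skip
  all_goals
    have hk1 := hne k ⟨i, by omega⟩
    have hk2 := hne k ⟨i + 1, h⟩
    have hm1 := hne m ⟨i, by omega⟩
    have hm2 := hne m ⟨i + 1, h⟩
    grind

theorem card_rothe_mul_simpleRefl {n i : ℕ} {w : Perm (Fin n)} (h : i + 1 < n)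
    (hw : w ⟨i, by omega⟩ < w ⟨i + 1, h⟩) :
    (rothe (w * simpleRefl n i)).card = (rothe w).card + 1 := by
  rw [rothe_mul_simpleRefl h hw, Finset.card_insert_of_notMem, Finset.card_map]
  rw [Finset.mem_map_equiv]
  have e1 : ((simpleRefl n i).prodCongr (Equiv.refl (Fin n))).symm
      ((⟨i, by omega⟩ : Fin n), w ⟨i, by omega⟩) =
      (⟨i + 1, h⟩, w ⟨i, by omega⟩) := by
    simp [simpleRefl_symm, simpleRefl_apply h]
  rw [e1, mem_rothe]
  simp only [Fin.mk_lt_mk]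
  omega

/-- `w` avoids the pattern `132`. -/
def Dominant {n : ℕ} (w : Perm (Fin n)) : Prop :=
  ∀ a b c : Fin n, a < b → b < c → w a < w c → ¬ w c < w b

theorem Dominant.mul_simpleRefl {n i : ℕ} {w : Perm (Fin n)} (hd : Dominant w) (h : i + 1 < n)
    (hw : w ⟨i, by omega⟩ < w ⟨i + 1, h⟩)
    (hfirst : ∀ a : Fin n, (a : ℕ) < i → w ⟨i, by omega⟩ < w a) :
    Dominant (w * simpleRefl n i) := by
  intro a b c hab hbc h1 h2
  have key := hd (simpleRefl n i a) (simpleRefl n i b) (simpleRefl n i c)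
  simp only [Perm.mul_apply] at h1 h2
  have hne : ∀ a b : Fin n, (a : ℕ) = b → w a = w b := fun a b hab => by rw [Fin.ext hab]
  by_cases hb : (b : ℕ) = i ∧ (c : ℕ) = i + 1
  · have := hfirst a (by have : (a : ℕ) < b := hab; omega)
    rw [simpleRefl_apply h a, simpleRefl_apply h c] at h1
    simp only [Fin.lt_def] at *
    have e1 : (a : ℕ) ≠ i := by omega
    have e2 : (a : ℕ) ≠ i + 1 := by omega
    simp only [hb.2, e1, e2, if_false, if_true] at h1
    simp at h1
    omega
  · by_cases ha : (a : ℕ) = i ∧ (b : ℕ) = i + 1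
    · have e1 : (c : ℕ) ≠ i := by simp only [Fin.lt_def] at *; omega
      have e2 : (c : ℕ) ≠ i + 1 := by simp only [Fin.lt_def] at *; omega
      rw [simpleRefl_apply h a, simpleRefl_apply h c] at h1
      rw [simpleRefl_apply h b, simpleRefl_apply h c] at h2
      simp only [ha, e1, e2, if_false, if_true] at h1 h2
      simp only [Nat.succ_ne_self, if_false] at h2
      exact absurd (h1.trans h2) hw.not_gt
    · refine key ?_ ?_ h1 h2
      · simp only [simpleRefl_apply h, Fin.lt_def] at *; grind
      · simp only [simpleRefl_apply h, Fin.lt_def] at *; grind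

theorem exists_first_ascent {n : ℕ} (w : Perm (Fin n)) (hw : ∃ i, IsAscent w i) :
    ∃ i, ∃ h : i + 1 < n, w ⟨i, by omega⟩ < w ⟨i + 1, h⟩ ∧
      ∀ a : Fin n, (a : ℕ) < i → w ⟨i, by omega⟩ < w a := by
  classical
  obtain ⟨h, h1⟩ := Nat.find_spec hw
  refine ⟨Nat.find hw, h, h1, fun a ha => ?_⟩
  have hmin : ∀ m, m < Nat.find hw → ∀ h : m + 1 < n, w ⟨m + 1, h⟩ < w ⟨m, by omega⟩ := by
    intro m hm h'
    have := Nat.find_min hw hm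
    refine lt_of_le_of_ne (not_lt.mp fun hlt => this ⟨h', hlt⟩) fun e => ?_
    simpa using w.injective e
  have : ∀ m, (a : ℕ) + 1 ≤ m → m ≤ Nat.find hw → ∀ h : m < n, w ⟨m, h⟩ < w a := by
    intro m hm
    induction m, hm using Nat.le_induction with
    | base => intro h2 h3; exact hmin a ha h3
    | succ m hm ih =>
      intro h2 h3
      exact (hmin m (by omega) h3).trans (ih (by omega) (by omega))
  exact this _ ha le_rfl _

theorem eq_revPerm_of_no_ascent {n : ℕ} (w : Perm (Fin n)) (hw : ¬ ∃ i, IsAscent w i) :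
    w = Fin.revPerm := by
  have h1 : StrictAnti w := by
    rcases n with _ | n
    · intro a; exact a.elim0
    · refine Fin.strictAnti_iff_succ_lt.mpr fun i => ?_
      refine lt_of_le_of_ne (not_lt.mp fun hlt => hw ⟨i, by omega, hlt⟩) fun e => ?_
      have := w.injective e
      simp [Fin.ext_iff] at this
  have h2 : StrictMono (fun k => w (Fin.rev k)) := fun a b hab => h1 (Fin.rev_lt_rev.mpr hab)
  have h3 : (fun k => w (Fin.rev k)) = id := by
    let e : Fin n ≃o Fin n :=
      StrictMono.orderIsoOfSurjective _ h2 (w.surjective.comp Fin.rev_surjective)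
    have : e = OrderIso.refl _ := Subsingleton.elim _ _
    funext k
    exact congrArg (fun f : Fin n ≃o Fin n => f k) this
  ext k
  have := congrFun h3 (Fin.rev k)
  simp at this
  simp [this]

theorem swapX_y (i j : ℕ) : swapX i (y j) = y j := by
  simp [swapX, y, Equiv.swap_apply_of_ne_of_ne]

theorem swapX_x {n i : ℕ} (h : i + 1 < n) (k : Fin n) :
    swapX i (x k) = x (simpleRefl n i k) := by
  rw [simpleRefl_apply h]
  split_ifs with h1 h2
  · rw [h1, swapX_x_left]
  · rw [h2, swapX_x_right]
  · exact swapX_x_of_ne h1 h2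

theorem betaSchubert_of_dominant {n : ℕ} (w : Perm (Fin n)) (hd : Dominant w) :
    betaSchubert w = ∏ ij ∈ rothe w, (x ij.1 - y ij.2 + β * x ij.1 * y ij.2) := by
  induction hm : weightedSum w using Nat.strong_induction_on generalizing w with
  | _ m ih =>
  subst hm
  by_cases hw : ∃ i, IsAscent w i
  · obtain ⟨i, h, hlt, hfirst⟩ := exists_first_ascent w hw
    have hi : IsAscent w i := ⟨h, hlt⟩
    rw [betaSchubert_of_isAscent w hi]
    have hins := rothe_mul_simpleRefl h hlt
    have hnot : ((⟨i, by omega⟩ : Fin n), w ⟨i, by omega⟩) ∉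
        (rothe w).map ((simpleRefl n i).prodCongr (Equiv.refl _)).toEmbedding := by
      intro hmem
      have := card_rothe_mul_simpleRefl h hlt
      rw [hins, Finset.insert_eq_self.mpr hmem, Finset.card_map] at this
      omega
    have hinv : (rothe w).map ((simpleRefl n i).prodCongr (Equiv.refl _)).toEmbedding =
        rothe w := by
      ext ⟨k, j⟩
      obtain ⟨m, rfl⟩ := w.surjective j
      rw [Finset.mem_map_equiv]
      have e1 : ((simpleRefl n i).prodCongr (Equiv.refl (Fin n))).symm (k, w m) =
        (simpleRefl n i k, w m) := by
        simp [simpleRefl_symm]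
      rw [e1, mem_rothe, mem_rothe, simpleRefl_apply h]
      have hne : ∀ a b : Fin n, (a : ℕ) = b → w a = w b := fun a b hab => by rw [Fin.ext hab]
      have hne' : ∀ a b : Fin n, (w a : ℕ) = w b → (a : ℕ) = b :=
        fun a b hab => by rw [w.injective (Fin.ext hab)]
      have hk1 := hne k ⟨i, by omega⟩
      have hk2 := hne k ⟨i + 1, h⟩
      have hm1 := hne' m ⟨i, by omega⟩
      have hm2 := hne' m ⟨i + 1, h⟩
      have hm3 := hne m ⟨i + 1, h⟩
      have hm4 := hne m ⟨i, by omega⟩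
      have hdd := hd ⟨i, by omega⟩ ⟨i + 1, h⟩ m (by simp [Fin.lt_def])
      simp only [Fin.lt_def] at *
      grind
    rw [ih _ (weightedSum_lt hi) _ (hd.mul_simpleRefl h hlt hfirst) rfl, hins,
      Finset.prod_insert hnot, hinv]
    have hsym : swapX i (∏ ij ∈ rothe w, (x ij.1 - y ij.2 + β * x ij.1 * y ij.2)) =
        ∏ ij ∈ rothe w, (x ij.1 - y ij.2 + β * x ij.1 * y ij.2) := by
      conv_rhs => rw [← hinv, Finset.prod_map]
      rw [map_prod]
      refine Finset.prod_congr rfl fun ij _ => ?_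
      simp [swapX_x h, swapX_y, swapX_beta]
    apply mul_left_cancel₀ (x_sub_x_ne_zero (show i ≠ i + 1 by omega))
    rw [betaDivDiff_spec, map_mul, hsym]
    simp only [map_add, map_sub, map_mul, swapX_x_left, swapX_y, swapX_beta]
    ring
  · rw [eq_revPerm_of_no_ascent w hw, betaSchubert_revPerm]
    refine Finset.prod_congr ?_ fun _ _ => rfl
    ext ⟨i, j⟩
    simp [rothe, Fin.lt_def]
    omega

theorem mem_pipe {n c : ℕ} {w : Perm (Fin n)} {P : Config n} : P ∈ Pipe c w ↔
    Relation.ReflTransGen (fun P P' => (Move P P' ∨ KMove P P') ∧ InColumns c P') (rothe w) P := by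
  simp [Pipe]

theorem mem_reducedPipe {n c : ℕ} {w : Perm (Fin n)} {P : Config n} : P ∈ ReducedPipe c w ↔
    Relation.ReflTransGen (fun P P' => Move P P' ∧ InColumns c P') (rothe w) P := by
  simp [ReducedPipe]

theorem Dominant.pipe_eq {n : ℕ} {w : Perm (Fin n)} (hd : Dominant w) (c : ℕ) :
    Pipe c w = {rothe w} := by
  have hno : ∀ i i' j j', ¬ IsExcitable (rothe w) i i' j j' := by
    rintro i i' j j' ⟨hi, -, -, h1, -, h2⟩
    obtain ⟨m, rfl⟩ := w.surjective j'
    rw [mem_rothe] at h1 h2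
    have hii : i < i' := by simp only [Fin.lt_def]; omega
    have him : i < m := hii.trans h2.2
    have hmi : ¬ w m < w i := fun h => h1 ⟨h, him⟩
    exact hd i i' m hii h2.2 (lt_of_le_of_ne (not_lt.mp hmi) fun e => him.ne (w.injective e)) h2.1
  ext P
  rw [mem_pipe, Finset.mem_singleton]
  constructor
  · intro h
    rcases Relation.ReflTransGen.cases_head h with rfl | ⟨P', ⟨h1 | h1, -⟩, -⟩
    · rfl
    · obtain ⟨i, i', j, j', he, -⟩ := h1; exact absurd he (hno _ _ _ _)
    · obtain ⟨i, i', j, j', he, -⟩ := h1; exact absurd he (hno _ _ _ _)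
  · rintro rfl; exact .refl

theorem card_le_of_mem_pipe {n c : ℕ} {w : Perm (Fin n)} {P : Config n} (h : P ∈ Pipe c w) :
    (rothe w).card ≤ P.card := by
  rw [mem_pipe] at h
  induction h with
  | refl => rfl
  | tail _ h ih =>
    refine ih.trans ?_
    rcases h.1 with ⟨i, i', j, j', he, rfl⟩ | ⟨i, i', j, j', he, rfl⟩
    · rw [Finset.card_insert_of_notMem (fun h => he.2.2.1 (Finset.mem_of_mem_erase h)),
        Finset.card_erase_of_mem he.2.2.2.2.2]
      omega
    · exact Finset.card_le_card (Finset.subset_insert _ _)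

theorem Move.card_eq {n : ℕ} {P P' : Config n} (h : Move P P') : P'.card = P.card := by
  obtain ⟨i, i', j, j', he, rfl⟩ := h
  rw [Finset.card_insert_of_notMem (fun h => he.2.2.1 (Finset.mem_of_mem_erase h)),
    Finset.card_erase_of_mem he.2.2.2.2.2]
  have := Finset.card_pos.mpr ⟨_, he.2.2.2.2.2⟩
  omega

theorem KMove.card_eq {n : ℕ} {P P' : Config n} (h : KMove P P') : P'.card = P.card + 1 := by
  obtain ⟨i, i', j, j', he, rfl⟩ := h
  exact Finset.card_insert_of_notMem he.2.2.1

theorem mem_reducedPipe_iff_card {n c : ℕ} {w : Perm (Fin n)} {P : Config n} :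
    P ∈ ReducedPipe c w ↔ P ∈ Pipe c w ∧ P.card = (rothe w).card := by
  constructor
  · intro h
    rw [mem_reducedPipe] at h
    induction h with
    | refl => exact ⟨mem_pipe.mpr .refl, rfl⟩
    | tail _ h ih =>
      exact ⟨mem_pipe.mpr ((mem_pipe.mp ih.1).tail ⟨.inl h.1, h.2⟩), h.1.card_eq.trans ih.2⟩
  · rintro ⟨h, hc⟩
    rw [mem_pipe] at h
    rw [mem_reducedPipe]
    induction h with
    | refl => exact .refl
    | tail h0 h ih =>
      rcases h with ⟨h | h, h'⟩
      · exact (ih (h.card_eq ▸ hc)).tail ⟨h, h'⟩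
      · have := card_le_of_mem_pipe (mem_pipe.mpr h0)
        have := h.card_eq
        omega

/-! ### A five-vertex model -/

section VertexModel

variable {R : Type*} [CommRing R]

/-- The colours of the horizontal edges of a row of tiles, when `L` enters on the left, `t` from
above, and the crossing tiles are given by `S`: a crossing sends `true` to the right, and any other
tile sends the colour coming from above to the right. -/
def hor {q : ℕ} (L : Bool) (t S : Fin q → Bool) : Fin (q + 1) → Bool :=
  Fin.cons L fun j => S j || t j

/-- The colours of the vertical edges below a row of tiles. -/
def down {q : ℕ} (L : Bool) (t S : Fin q → Bool) (j : Fin q) : Bool :=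
  !S j && hor L t S j.castSucc

/-- Different colours enter each crossing, and `ε` leaves the row on the right. -/
def RowValid {q : ℕ} (L : Bool) (t : Fin q → Bool) (ε : Bool) (S : Fin q → Bool) : Prop :=
  (∀ j, S j = true → t j ≠ hor L t S j.castSucc) ∧ hor L t S (Fin.last q) = ε

/-- The weight of a row of tiles. -/
def rowWeight {q : ℕ} (X : R) (Y : Fin q → R) (S : Fin q → Bool) : R :=
  ∏ j, if S j then X * Y j - 1 else 1

open Classical in
/-- The row transfer operator. -/
def rowSum {q : ℕ} (X : R) (Y : Fin q → R) (L : Bool) (t : Fin q → Bool) (ε : Bool)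
    (F : (Fin q → Bool) → R) : R :=
  ∑ S, if RowValid L t ε S then rowWeight X Y S * F (down L t S) else 0

theorem hor_cons {q : ℕ} (L t₀ s : Bool) (t S : Fin q → Bool) :
    hor L (Fin.cons t₀ t : Fin (q + 1) → Bool) (Fin.cons s S : Fin (q + 1) → Bool) =
      (Fin.cons L (hor (s || t₀) t S) : Fin (q + 2) → Bool) := by
  unfold hor
  congr 1
  funext j
  refine Fin.cases ?_ (fun j => ?_) j <;> simp

theorem down_cons {q : ℕ} (L t₀ s : Bool) (t S : Fin q → Bool) :
    down L (Fin.cons t₀ t : Fin (q + 1) → Bool) (Fin.cons s S : Fin (q + 1) → Bool) =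
      (Fin.cons (!s && L) (down (s || t₀) t S) : Fin (q + 1) → Bool) := by
  funext j
  refine Fin.cases ?_ (fun j => ?_) j
  · simp [down, hor]
  · simp only [down, hor_cons, Fin.cons_succ, ← Fin.succ_castSucc]

theorem rowValid_cons {q : ℕ} (L t₀ s ε : Bool) (t S : Fin q → Bool) :
    RowValid L (Fin.cons t₀ t : Fin (q + 1) → Bool) ε (Fin.cons s S : Fin (q + 1) → Bool) ↔
      (s = true → t₀ ≠ L) ∧ RowValid (s || t₀) t ε S := by
  unfold RowValid
  rw [Fin.forall_fin_succ, ← Fin.succ_last]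
  simp only [hor_cons, Fin.cons_succ, Fin.cons_zero, ← Fin.succ_castSucc, and_assoc,
    Fin.castSucc_zero]

theorem sum_fin_succ_bool {M : Type*} [AddCommMonoid M] {q : ℕ} (f : (Fin (q + 1) → Bool) → M) :
    ∑ S, f S = ∑ S : Fin q → Bool, f (Fin.cons false S) + ∑ S : Fin q → Bool, f (Fin.cons true S) := by
  rw [← (Fin.consEquiv (fun _ => Bool)).sum_comp, Fintype.sum_prod_type, Fintype.sum_bool, add_comm]
  rfl

theorem rowSum_cons {q : ℕ} (X : R) (Y : Fin (q + 1) → R) (L t₀ : Bool) (t : Fin q → Bool)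
    (ε : Bool) (F : (Fin (q + 1) → Bool) → R) :
    rowSum X Y L (Fin.cons t₀ t) ε F =
      rowSum X (Fin.tail Y) t₀ t ε (fun b => F (Fin.cons L b)) +
      if t₀ ≠ L then
        (X * Y 0 - 1) * rowSum X (Fin.tail Y) true t ε (fun b => F (Fin.cons false b))
      else 0 := by
  classical
  unfold rowSum
  rw [sum_fin_succ_bool]
  congr 1
  · refine Finset.sum_congr rfl fun S _ => ?_
    simp only [rowWeight, Fin.prod_univ_succ, down_cons, Fin.cons_zero, Fin.cons_succ, Fin.tail]
    refine if_congr ?_ (by simp) rfl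
    simp [rowValid_cons]
  · by_cases h : t₀ = L
    · rw [if_neg (by simpa using h)]
      refine Finset.sum_eq_zero fun S _ => if_neg ?_
      simp [rowValid_cons, h]
    · rw [if_pos h, Finset.mul_sum]
      refine Finset.sum_congr rfl fun S _ => ?_
      simp only [rowWeight, Fin.prod_univ_succ, down_cons, Fin.cons_zero, Fin.cons_succ, Fin.tail]
      rw [mul_ite, mul_zero]
      refine if_congr ?_ (by simp [mul_assoc]) rfl
      simp [rowValid_cons, h]

theorem rowSum_zero (X : R) (Y : Fin 0 → R) (L : Bool) (t : Fin 0 → Bool)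
    (ε : Bool) (F : (Fin 0 → Bool) → R) :
    rowSum X Y L t ε F = if L = ε then F t else 0 := by
  classical
  unfold rowSum
  rw [Fintype.sum_unique]
  refine if_congr (by simp [RowValid, hor]) ?_ rfl
  have : ∀ S, rowWeight X Y S * F (down L t S) = F t := fun S => by
    rw [Subsingleton.elim (down L t S) t]; simp [rowWeight]
  exact this _

theorem rowSum_add {q : ℕ} (X : R) (Y : Fin q → R) (L : Bool) (t : Fin q → Bool) (ε : Bool)
    (F G : (Fin q → Bool) → R) :
    rowSum X Y L t ε (fun b => F b + G b) = rowSum X Y L t ε F + rowSum X Y L t ε G := by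
  classical
  unfold rowSum
  rw [← Finset.sum_add_distrib]
  refine Finset.sum_congr rfl fun S _ => ?_
  split_ifs <;> ring

theorem rowSum_mul {q : ℕ} (X : R) (Y : Fin q → R) (L : Bool) (t : Fin q → Bool) (ε : Bool)
    (a : R) (F : (Fin q → Bool) → R) :
    rowSum X Y L t ε (fun b => a * F b) = a * rowSum X Y L t ε F := by
  classical
  unfold rowSum
  rw [Finset.mul_sum]
  refine Finset.sum_congr rfl fun S _ => ?_
  split_ifs <;> ring

/-- The transfer operator of two consecutive rows. -/
def twoRows {q : ℕ} (X X' : R) (Y : Fin q → R) (L L' : Bool) (t : Fin q → Bool) (ε ε' : Bool)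
    (F : (Fin q → Bool) → R) : R :=
  rowSum X Y L t ε fun b => rowSum X' Y L' b ε' F

theorem twoRows_exchange_aux {q : ℕ} (X X' : R) (Y : Fin q → R) (t : Fin q → Bool)
    (F : (Fin q → Bool) → R) :
    let g := fun L L' => X' * twoRows X X' Y L L' t true false F -
      (X - X') * twoRows X X' Y L L' t false true F
    let g' := fun L L' => twoRows X' X Y L L' t true false F
    g true true = X * g' true true ∧ g false false = X * g' false false ∧
      g false true = X * g' false true - (X - X') * g' true false ∧
      g true false = X' * g' true false := by
  induction q with
  | zero =>
    simp [twoRows, rowSum_zero]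
  | succ q ih =>
    obtain ⟨t₀, t, rfl⟩ : ∃ t₀ t', t = Fin.cons t₀ t' := ⟨t 0, Fin.tail t, by simp⟩
    have i0 := ih (Fin.tail Y) t (fun b => F (Fin.cons false b))
    have i1 := ih (Fin.tail Y) t (fun b => F (Fin.cons true b))
    clear ih
    simp only [twoRows] at i0 i1 ⊢
    simp only [rowSum_cons]
    obtain ⟨a1, a2, a3, a4⟩ := i0
    obtain ⟨b1, b2, b3, b4⟩ := i1
    set h := X * Y 0 - 1 with hh
    set h' := X' * Y 0 - 1 with hh'
    cases t₀ <;>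
    simp only [rowSum_add, rowSum_mul, ne_eq, not_true_eq_false, if_false, add_zero,
      not_false_eq_true, if_true, reduceCtorEq] <;>
    refine ⟨?_, ?_, ?_, ?_⟩
    · linear_combination b3 + h * b4 + h * h' * a1
    · linear_combination a2
    · linear_combination b2 + h' * a3
    · linear_combination (1 + h') * a3 + h * a4
    · linear_combination b1
    · linear_combination (1 + h) * a4
    · linear_combination (1 + h) * (b4 + h' * a1)
    · linear_combination (1 + h') * a1

theorem twoRows_exchange {q : ℕ} (X X' : R) (Y : Fin q → R) (t : Fin q → Bool)
    (F : (Fin q → Bool) → R) :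
    (X - X') * twoRows X X' Y true true t false true F =
      X' * twoRows X X' Y true true t true false F -
        X * twoRows X' X Y true true t true false F := by
  have := (twoRows_exchange_aux X X' Y t F).1
  simp only at this
  linear_combination -this

/-- The partition function of `n` rows of tiles: `true` enters every row on the left and leaves
every column at the bottom, `t` enters from above, and `ε i` leaves the row `i` on the right. -/
def partitionSum {q : ℕ} (Y : Fin q → R) :
    (n : ℕ) → (Fin n → R) → (Fin n → Bool) → (Fin q → Bool) → R
  | 0, _, _, t => if t = fun _ => true then 1 else 0
  | n + 1, X, ε, t => rowSum (X 0) Y true t (ε 0) (partitionSum Y n (Fin.tail X) (Fin.tail ε))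

theorem partitionSum_exchange {q : ℕ} (Y : Fin q → R) (n : ℕ) (X X' : Fin n → R)
    (ε ε' : Fin n → Bool) (t : Fin q → Bool) (i : ℕ) (h : i + 1 < n)
    (hX : ∀ k : Fin n, X' k = if (k : ℕ) = i then X ⟨i + 1, h⟩ else
      if (k : ℕ) = i + 1 then X ⟨i, by omega⟩ else X k)
    (hε : ∀ k : Fin n, ε' k = if (k : ℕ) = i then true else
      if (k : ℕ) = i + 1 then false else ε k)
    (h0 : ε ⟨i, by omega⟩ = false) (h1 : ε ⟨i + 1, h⟩ = true) :
    (X ⟨i, by omega⟩ - X ⟨i + 1, h⟩) * partitionSum Y n X ε t =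
      X ⟨i + 1, h⟩ * partitionSum Y n X ε' t - X ⟨i, by omega⟩ * partitionSum Y n X' ε' t := by
  induction n generalizing i t with
  | zero => omega
  | succ n ih =>
    rcases i with _ | i
    · rcases n with _ | n
      · omega
      have e1 : Fin.tail (Fin.tail X') = Fin.tail (Fin.tail X) := by
        funext k; simp [Fin.tail, hX]
      have e2 : Fin.tail (Fin.tail ε') = Fin.tail (Fin.tail ε) := by
        funext k; simp [Fin.tail, hε]
      have := twoRows_exchange (X 0) (X 1) Y t
        (partitionSum Y n (Fin.tail (Fin.tail X)) (Fin.tail (Fin.tail ε)))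
      have x0 : X' 0 = X 1 := by simp [hX]
      have x1 : Fin.tail X' 0 = X 0 := by simp [hX, Fin.tail]
      have y0 : ε' 0 = true := by simp [hε]
      have y1 : Fin.tail ε' 0 = false := by simp [hε, Fin.tail]
      have z0 : ε 0 = false := h0
      have z1 : Fin.tail ε 0 = true := h1
      simp only [partitionSum, e1, e2, x0, x1, y0, y1, z0, z1]
      exact this
    · have := fun b => ih (Fin.tail X) (Fin.tail X') (Fin.tail ε) (Fin.tail ε') b i (by omega)
        (by intro k; simp only [Fin.tail, hX]; simp) (by intro k; simp only [Fin.tail, hε]; simp)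
        h0 h1
      have e1 : X' 0 = X 0 := by simp [hX]
      have e2 : ε' 0 = ε 0 := by simp [hε]
      simp only [Fin.tail, Fin.succ_mk] at this
      simp only [partitionSum, e1, e2]
      rw [← rowSum_mul, funext this]
      simp only [sub_eq_add_neg, rowSum_add, ← neg_mul, rowSum_mul]

theorem map_rowSum {R' : Type*} [CommRing R'] (φ : R →+* R') {q : ℕ} (X : R) (Y : Fin q → R)
    (L : Bool) (t : Fin q → Bool) (ε : Bool) (F : (Fin q → Bool) → R) :
    φ (rowSum X Y L t ε F) = rowSum (φ X) (φ ∘ Y) L t ε (φ ∘ F) := by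
  classical
  simp only [rowSum, rowWeight, map_sum, apply_ite φ, map_mul, map_prod, map_sub, map_one, map_zero,
    Function.comp]

theorem map_partitionSum {R' : Type*} [CommRing R'] (φ : R →+* R') {q : ℕ} (Y : Fin q → R) (n : ℕ)
    (X : Fin n → R) (ε : Fin n → Bool) (t : Fin q → Bool) :
    φ (partitionSum Y n X ε t) = partitionSum (φ ∘ Y) n (φ ∘ X) ε t := by
  induction n generalizing t with
  | zero => simp [partitionSum, apply_ite φ]
  | succ n ih =>
    simp only [partitionSum, map_rowSum]
    congr 1
    funext b
    exact ih _ _ b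

/-- The admissible placements of crossings in `n` rows of tiles. -/
def Admissible {q : ℕ} : (n : ℕ) → (Fin n → Bool) → (Fin q → Bool) → (Fin n → Fin q → Bool) → Prop
  | 0, _, t, _ => t = fun _ => true
  | n + 1, ε, t, Q => RowValid true t (ε 0) (Q 0) ∧
      Admissible n (Fin.tail ε) (down true t (Q 0)) (Fin.tail Q)

open Classical in
theorem partitionSum_eq_sum {q : ℕ} (Y : Fin q → R) (n : ℕ) (X : Fin n → R) (ε : Fin n → Bool)
    (t : Fin q → Bool) :
    partitionSum Y n X ε t = ∑ Q, if Admissible n ε t Q then ∏ i, rowWeight (X i) Y (Q i) else 0 := by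
  induction n generalizing t with
  | zero => rw [Fintype.sum_unique]; simp [partitionSum, Admissible]
  | succ n ih =>
    rw [← (Fin.consEquiv (fun _ => Fin q → Bool)).sum_comp, Fintype.sum_prod_type]
    simp only [partitionSum, rowSum, ih]
    refine Finset.sum_congr rfl fun S _ => ?_
    by_cases h : RowValid true t (ε 0) S
    · rw [if_pos h, Finset.mul_sum]
      refine Finset.sum_congr rfl fun Q _ => ?_
      rw [mul_ite, mul_zero]
      refine if_congr ?_ (by simp [Fin.prod_univ_succ, Fin.tail, Fin.consEquiv]) rfl
      simp [Admissible, h, Fin.consEquiv]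
    · rw [if_neg h]
      refine (Finset.sum_eq_zero fun Q _ => if_neg ?_).symm
      simp [Admissible, h, Fin.consEquiv]

end VertexModel

/-! ### Admissible configurations in the quarter plane -/

/-- The colours of the vertical edges: `gridV t P i j` belongs to the upper edge of the tile
`(i, j)`, where `t` enters from above, `True` enters every row on the left, and `P` is the set of
crossings. -/
def gridV (t : ℕ → Prop) (P : ℕ → ℕ → Prop) : ℕ → ℕ → Prop
  | 0, j => t j
  | i + 1, 0 => ¬ P i 0
  | i + 1, j + 1 => ¬ P i (j + 1) ∧ (P i j ∨ gridV t P i j)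

/-- The colours of the horizontal edges: `gridH t P i j` belongs to the left edge of the tile
`(i, j)`. -/
def gridH (t : ℕ → Prop) (P : ℕ → ℕ → Prop) (i : ℕ) : ℕ → Prop
  | 0 => True
  | j + 1 => P i j ∨ gridV t P i j

theorem gridV_succ (t : ℕ → Prop) (P : ℕ → ℕ → Prop) (i j : ℕ) :
    gridV t P (i + 1) j ↔ ¬ P i j ∧ gridH t P i j := by
  cases j <;> simp [gridV, gridH]

theorem gridH_succ (t : ℕ → Prop) (P : ℕ → ℕ → Prop) (i j : ℕ) :
    gridH t P i (j + 1) ↔ P i j ∨ gridV t P i j := Iff.rfl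

/-- The crossings `P` lie in an `n × q` grid, different colours enter each crossing, `¬ A i` leaves
the row `i` on the right, and `True` leaves every column at the bottom. -/
structure GridValid (n q : ℕ) (A : ℕ → Prop) (t : ℕ → Prop) (P : ℕ → ℕ → Prop) : Prop where
  bound : ∀ i j, P i j → i < n ∧ j < q
  cross : ∀ i j, P i j → (gridV t P i j ↔ ¬ gridH t P i j)
  right : ∀ i, i < n → (gridH t P i q ↔ ¬ A i)
  bottom : ∀ j, j < q → gridV t P n j

/-- `P'` is obtained from `P` by a move, of either kind, that puts a crossing at `(i, j)`. -/
structure GridMove (i j : ℕ) (P P' : ℕ → ℕ → Prop) : Prop where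
  ul : ¬ P i j
  ur : ¬ P i (j + 1)
  ll : ¬ P (i + 1) j
  lr : P (i + 1) (j + 1)
  ul' : P' i j
  off : ∀ a b, ¬ (a = i ∧ b = j) → ¬ (a = i + 1 ∧ b = j + 1) → (P' a b ↔ P a b)

section GridMove

variable {i j : ℕ} {P P' : ℕ → ℕ → Prop} {t : ℕ → Prop}

theorem GridMove.gridV_iff (h : GridMove i j P P')
    (hc : ¬ (gridV t P i j ↔ gridH t P i j)) (a b : ℕ)
    (hab : ¬ (a = i + 1 ∧ (b = j ∨ b = j + 1))) : gridV t P' a b ↔ gridV t P a b := by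
  induction a generalizing b with
  | zero => rfl
  | succ a ih =>
    have hH : ∀ b, ¬ (a = i ∧ b = j + 1) → ¬ (a = i + 1 ∧ (b = j + 1 ∨ b = j + 2)) →
        (gridH t P' a b ↔ gridH t P a b) := by
      intro b h1 h2
      rcases b with _ | b
      · rfl
      rw [gridH_succ, gridH_succ, ih b (by omega), h.off a b (by omega) (by omega)]
    rw [gridV_succ, gridV_succ]
    by_cases ha : a = i
    · subst ha
      rw [hH b (by omega) (by omega), h.off a b (by omega) (by omega)]
    by_cases ha : a = i + 1
    · subst ha
      by_cases hb : b = j + 1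
      · subst hb
        have e1 := h.lr
        have e2 := h.ll
        have e4 := h.ul
        have e5 := h.ul'
        have e3 := (h.off (i + 1) j (by omega) (by omega))
        simp only [gridH_succ, gridV_succ, e1, e2, e3, e4, e5]
        simp
      by_cases hb : b = j + 2
      · subst hb
        have e1 := h.lr
        have e2 := h.ur
        have e3 := h.off i (j + 1) (by omega) (by omega)
        have e5 := h.ul'
        have e4 := h.off (i + 1) (j + 2) (by omega) (by omega)
        simp only [gridH_succ, gridV_succ, e1, e2, e3, e4, e5]
        simp
      rw [hH b (by omega) (by omega), h.off (i + 1) b (by omega) (by omega)]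
    · rw [hH b (by omega) (by omega), h.off a b (by omega) (by omega)]

theorem GridMove.gridH_iff (h : GridMove i j P P')
    (hc : ¬ (gridV t P i j ↔ gridH t P i j)) (a b : ℕ)
    (hab : ¬ (a = i ∧ b = j + 1)) (hab' : ¬ (a = i + 1 ∧ b = j + 1)) :
    gridH t P' a b ↔ gridH t P a b := by
  rcases b with _ | b
  · rfl
  rw [gridH_succ, gridH_succ]
  by_cases ha : a = i + 1 ∧ b = j + 1
  · obtain ⟨rfl, rfl⟩ := ha
    have e1 := h.lr
    have e2 := h.ur
    have e3 := h.off i (j + 1) (by omega) (by omega)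
    have e5 := h.ul'
    simp only [gridV_succ, gridH_succ, e1, e2, e3, e5]
    simp
  · rw [h.gridV_iff hc a b (by omega), h.off a b (by omega) (by omega)]

theorem gridV_congr (h : ∀ a, a < i → ∀ b, P' a b ↔ P a b) (b : ℕ) :
    gridV t P' i b ↔ gridV t P i b := by
  induction i generalizing b with
  | zero => rfl
  | succ i ih =>
    rcases b with _ | b
    · simp [gridV, h i (by omega)]
    · simp [gridV, h i (by omega), ih fun a ha => h a (by omega)]

theorem GridMove.gridV_corner (h : GridMove i j P P') : gridV t P' i j ↔ gridV t P i j :=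
  gridV_congr (fun a ha b => h.off a b (by omega) (by omega)) j

theorem GridMove.gridH_corner (h : GridMove i j P P') : gridH t P' i j ↔ gridH t P i j := by
  rcases j with _ | j
  · rfl
  · rw [gridH_succ, gridH_succ, h.off i j (by omega) (by omega),
      gridV_congr (fun a ha b => h.off a b (by omega) (by omega)) j]

theorem GridMove.gridValid_iff {n q : ℕ} {A : ℕ → Prop} (h : GridMove i j P P') (hi : i + 1 < n)
    (hj : j + 1 < q) : GridValid n q A t P' ↔ GridValid n q A t P := by
  have e2 := h.ur
  have e3 := h.ll
  have e4 := h.ul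
  have e5 := h.ul'
  have e6 := h.off i (j + 1) (by omega) (by omega)
  have e7 := h.off (i + 1) j (by omega) (by omega)
  have v1 : gridV t P (i + 1) (j + 1) ↔ gridV t P i j := by
    simp only [gridV_succ, gridH_succ, e2, e4]; simp
  have h1 : gridH t P (i + 1) (j + 1) ↔ gridH t P i j := by
    simp only [gridV_succ, gridH_succ, e3, e4]; simp
  constructor
  · intro H
    have hc : ¬ (gridV t P i j ↔ gridH t P i j) := by
      have := H.cross i j h.ul'
      rw [h.gridV_corner, h.gridH_corner] at this
      tauto
    refine ⟨fun a b hab => ?_, fun a b hab => ?_, fun a ha => ?_, fun b hb => ?_⟩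
    · by_cases h1 : a = i + 1 ∧ b = j + 1
      · omega
      · exact H.bound a b ((h.off a b (by rintro ⟨rfl, rfl⟩; exact e4 hab) h1).mpr hab)
    · by_cases h2 : a = i + 1 ∧ b = j + 1
      · obtain ⟨rfl, rfl⟩ := h2
        rw [v1, h1]; tauto
      · have n1 : ¬ (a = i ∧ b = j) := by rintro ⟨rfl, rfl⟩; exact e4 hab
        have n2 : ¬ (a = i ∧ b = j + 1) := by rintro ⟨rfl, rfl⟩; exact e2 hab
        have n3 : ¬ (a = i + 1 ∧ b = j) := by rintro ⟨rfl, rfl⟩; exact e3 hab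
        have := H.cross a b ((h.off a b n1 h2).mpr hab)
        rwa [h.gridV_iff hc a b (by omega), h.gridH_iff hc a b (by omega) (by omega)] at this
    · rw [← h.gridH_iff hc a q (by omega) (by omega)]; exact H.right a ha
    · rw [← h.gridV_iff hc n b (by omega)]; exact H.bottom b hb
  · intro H
    have hc : ¬ (gridV t P i j ↔ gridH t P i j) := by
      have := H.cross (i + 1) (j + 1) h.lr
      rw [v1, h1] at this
      tauto
    refine ⟨fun a b hab => ?_, fun a b hab => ?_, fun a ha => ?_, fun b hb => ?_⟩
    · by_cases h1 : a = i ∧ b = j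
      · omega
      by_cases h2 : a = i + 1 ∧ b = j + 1
      · omega
      · exact H.bound a b ((h.off a b h1 h2).mp hab)
    · by_cases h1 : a = i ∧ b = j
      · obtain ⟨rfl, rfl⟩ := h1
        rw [h.gridV_corner, h.gridH_corner]; tauto
      by_cases h2 : a = i + 1 ∧ b = j + 1
      · obtain ⟨rfl, rfl⟩ := h2
        simp only [gridV_succ, gridH_succ, e5, e6, e7, e2, e3]
        simp
      · have hab' := (h.off a b h1 h2).mp hab
        have n2 : ¬ (a = i ∧ b = j + 1) := by rintro ⟨rfl, rfl⟩; exact e2 hab'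
        have n3 : ¬ (a = i + 1 ∧ b = j) := by rintro ⟨rfl, rfl⟩; exact e3 hab'
        rw [h.gridV_iff hc a b (by omega), h.gridH_iff hc a b (by omega) (by omega)]
        exact H.cross a b hab'
    · rw [h.gridH_iff hc a q (by omega) (by omega)]; exact H.right a ha
    · rw [h.gridV_iff hc n b (by omega)]; exact H.bottom b hb

end GridMove

open Classical in
/-- The number of elements of `A` below `i`. -/
def countBelow (A : ℕ → Prop) (i : ℕ) : ℕ := ((Finset.range i).filter A).card

theorem countBelow_succ_of {A : ℕ → Prop} {i : ℕ} (h : A i) :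
    countBelow A (i + 1) = countBelow A i + 1 := by
  classical
  simp [countBelow, Finset.range_add_one, Finset.filter_insert, h]

theorem countBelow_succ_of_not {A : ℕ → Prop} {i : ℕ} (h : ¬ A i) :
    countBelow A (i + 1) = countBelow A i := by
  classical
  simp [countBelow, Finset.range_add_one, Finset.filter_insert, h]

/-- The Rothe diagram of the shuffle of `A`. -/
def gridRothe (n q : ℕ) (A : ℕ → Prop) (i j : ℕ) : Prop :=
  i < n ∧ j < q ∧ ¬ A i ∧ countBelow A i ≤ j

theorem gridV_gridRothe {n q : ℕ} {A : ℕ → Prop} {i j : ℕ} (hi : i ≤ n) (hj : j < q) :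
    gridV (fun _ => False) (gridRothe n q A) i j ↔ j < countBelow A i := by
  induction i generalizing j with
  | zero => simp [gridV, countBelow]
  | succ i ih =>
    by_cases hA : A i
    · rw [countBelow_succ_of hA]
      rcases j with _ | j
      · simp [gridV, gridRothe, hA]
      · rw [gridV, ih (by omega) (by omega)]
        simp [gridRothe, hA]
    · rw [countBelow_succ_of_not hA]
      rcases j with _ | j
      · simp only [gridV, gridRothe, hA]
        simp; omega
      · rw [gridV, ih (by omega) (by omega)]
        simp only [gridRothe, hA]
        simp; omega

theorem gridH_gridRothe {n q : ℕ} {A : ℕ → Prop} {i j : ℕ} (hi : i < n) (hj : j ≤ q) :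
    gridH (fun _ => False) (gridRothe n q A) i j ↔ (¬ A i ∨ j ≤ countBelow A i) := by
  rcases j with _ | j
  · simp [gridH]
  · rw [gridH_succ, gridV_gridRothe hi.le (by omega)]
    unfold gridRothe
    by_cases hA : A i <;> simp [hA]
    omega

theorem gridValid_gridRothe {n q : ℕ} {A : ℕ → Prop} (hq : countBelow A n = q) :
    GridValid n q A (fun _ => False) (gridRothe n q A) := by
  refine ⟨fun i j h => ⟨h.1, h.2.1⟩, fun i j h => ?_, fun i hi => ?_, fun j hj => ?_⟩
  · rw [gridV_gridRothe h.1.le h.2.1, gridH_gridRothe h.1 h.2.1.le]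
    have := h.2.2
    simp [this.1]; omega
  · rw [gridH_gridRothe hi le_rfl]
    by_cases hA : A i
    · have h1 := countBelow_succ_of hA
      have h2 : countBelow A (i + 1) ≤ countBelow A n := by
        classical
        exact Finset.card_le_card (Finset.filter_subset_filter _
          (Finset.range_subset_range.mpr (by omega)))
      simp [hA]; omega
    · simp [hA]
  · rw [gridV_gridRothe le_rfl hj]; omega

/-- If no `+` can be moved back, the configuration is the Rothe diagram. -/
theorem eq_gridRothe_of_rightJustified {n q : ℕ} {A : ℕ → Prop} {P : ℕ → ℕ → Prop}
    (h : GridValid n q A (fun _ => False) P)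
    (hr : ∀ i j, P i j → j + 1 < q → P i (j + 1)) (i j : ℕ) :
    P i j ↔ gridRothe n q A i j := by
  have hr' : ∀ i j k, P i j → j ≤ k → k < q → P i k := by
    intro i j k hP hjk
    induction k, hjk using Nat.le_induction with
    | base => intro _; exact hP
    | succ k hk ih => intro hq; exact hr i k (ih (by omega)) hq
  suffices H : ∀ i, i ≤ n → (∀ a, a < i → ∀ b, P a b ↔ gridRothe n q A a b) by
    by_cases hi : i < n
    · exact H n le_rfl i hi j
    · exact ⟨fun hP => absurd (h.bound i j hP).1 hi, fun hP => absurd hP.1 hi⟩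
  intro i
  induction i with
  | zero => intro _ a ha; omega
  | succ i ih =>
    intro hi a ha
    by_cases hai : a < i
    · exact ih (by omega) a hai
    obtain rfl : a = i := by omega
    have hV : ∀ j, j < q → (gridV (fun _ => False) P a j ↔ j < countBelow A a) := fun j hj => by
      rw [gridV_congr (P := gridRothe n q A) (ih (by omega)), gridV_gridRothe (by omega) hj]
    have hlow : ∀ j, j < q → j < countBelow A a → ¬ P a j ∧ gridH (fun _ => False) P a j := by
      intro j
      induction j with
      | zero =>
        intro h0 h1
        refine ⟨fun hP => ?_, trivial⟩
        exact (h.cross a 0 hP).mp ((hV 0 h0).mpr h1) trivial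
      | succ j ihj =>
        intro h0 h1
        have hH : gridH (fun _ => False) P a (j + 1) := .inr ((hV j (by omega)).mpr (by omega))
        refine ⟨fun hP => (h.cross a (j + 1) hP).mp ((hV _ h0).mpr h1) hH, hH⟩
    intro b
    by_cases hbq : b < q
    swap
    · exact ⟨fun hP => absurd (h.bound a b hP).2 hbq, fun hP => absurd hP.2.1 hbq⟩
    have hright := h.right a (by omega)
    obtain ⟨q', rfl⟩ : ∃ q', q = q' + 1 := ⟨q - 1, by omega⟩
    rw [gridH_succ, hV q' (by omega)] at hright
    constructor
    · intro hP
      refine ⟨by omega, hbq, ?_, ?_⟩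
      · exact hright.mp (.inl (hr' a b q' hP (by omega) (by omega)))
      · by_contra hlt
        exact (hlow b hbq (by omega)).1 hP
    · rintro ⟨-, -, hA, hle⟩
      have hVc := hV (countBelow A a)
      have hno : ¬ P a (countBelow A a) → ∀ m, countBelow A a ≤ m → m < q' + 1 → ¬ P a m := by
        intro hc m hm
        induction m, hm using Nat.le_induction with
        | base => intro _; exact hc
        | succ m hm ihm =>
          intro hmq hP
          have := h.cross a (m + 1) hP
          rw [gridH_succ, hV (m + 1) hmq, hV m (by omega)] at this
          have := ihm (by omega)
          have n1 : ¬ (m + 1 < countBelow A a) := by omega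
          have n2 : ¬ (m < countBelow A a) := by omega
          tauto
      have hPq : P a q' := (hright.mpr hA).resolve_right (by omega)
      refine hr' a _ b ?_ hle hbq
      by_contra hc
      exact hno hc q' (by omega) (by omega) hPq

theorem GridValid.exists_back {n q : ℕ} {A : ℕ → Prop} {P : ℕ → ℕ → Prop}
    (h : GridValid n q A (fun _ => False) P)
    (hne : ¬ ∀ i j, P i j ↔ gridRothe n q A i j) :
    ∃ i j, i + 1 < n ∧ j + 1 < q ∧ P i j ∧ ¬ P i (j + 1) ∧ ¬ P (i + 1) j := by
  classical
  let B : ℕ → Prop := fun i => ∃ j, P i j ∧ j + 1 < q ∧ ¬ P i (j + 1)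
  have hB : ∃ i, i ≤ n ∧ B i := by
    by_contra hB
    push Not at hB
    refine hne (eq_gridRothe_of_rightJustified h fun i j hP hj => ?_)
    by_contra hP'
    exact hB i (h.bound i j hP).1.le ⟨j, hP, hj, hP'⟩
  obtain ⟨i₀, hi₀, hBi₀⟩ := hB
  obtain ⟨j, hP, hj, hPj⟩ : B (Nat.findGreatest B n) := Nat.findGreatest_spec hi₀ hBi₀
  have hmax : ∀ k, Nat.findGreatest B n < k → k ≤ n → ¬ B k := fun k => Nat.findGreatest_is_greatest
  generalize Nat.findGreatest B n = i at *
  have hin := (h.bound i j hP).1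
  have hi : i + 1 < n := by
    by_contra hi
    obtain rfl : n = i + 1 := by omega
    have := h.bottom j (by omega)
    rw [gridV_succ] at this
    exact this.1 hP
  refine ⟨i, j, hi, hj, hP, hPj, fun hP1 => ?_⟩
  have hP2 : P (i + 1) (j + 1) := by
    by_contra hP2
    exact hmax (i + 1) (by omega) hi.le ⟨j, hP1, hj, hP2⟩
  have := h.cross (i + 1) (j + 1) hP2
  rw [gridV_succ, gridH_succ, gridH_succ] at this
  tauto

/-! ### Pipe diagrams are the admissible configurations -/

/-- The positions of the `+`'s, as natural numbers. -/
def plusAt {n : ℕ} (P : Config n) (i j : ℕ) : Prop := ∃ a ∈ P, (a.1 : ℕ) = i ∧ (a.2 : ℕ) = j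

theorem plusAt_val {n : ℕ} {P : Config n} {i j : Fin n} : plusAt P i j ↔ (i, j) ∈ P := by
  constructor
  · rintro ⟨⟨a, b⟩, h, h1, h2⟩
    rwa [← Fin.ext h1, ← Fin.ext h2]
  · intro h; exact ⟨_, h, rfl, rfl⟩

theorem plusAt_mk {n : ℕ} {P : Config n} {i j : ℕ} (hi : i < n) (hj : j < n) :
    plusAt P i j ↔ ((⟨i, hi⟩ : Fin n), (⟨j, hj⟩ : Fin n)) ∈ P :=
  plusAt_val (i := ⟨i, hi⟩) (j := ⟨j, hj⟩)

theorem plusAt_lt {n : ℕ} {P : Config n} {i j : ℕ} (h : plusAt P i j) : i < n ∧ j < n := by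
  obtain ⟨a, -, rfl, rfl⟩ := h
  exact ⟨a.1.2, a.2.2⟩

theorem config_ext {n : ℕ} {P P' : Config n} (h : ∀ i j, plusAt P i j ↔ plusAt P' i j) :
    P = P' := by
  ext ⟨i, j⟩
  rw [← plusAt_val, ← plusAt_val, h]

theorem plusAt_insert {n : ℕ} {P : Config n} {a b : Fin n} {i j : ℕ} :
    plusAt (insert (a, b) P) i j ↔ (i = a ∧ j = b) ∨ plusAt P i j := by
  simp only [plusAt, Finset.exists_mem_insert]
  grind

theorem plusAt_erase {n : ℕ} {P : Config n} {a b : Fin n} {i j : ℕ} :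
    plusAt (P.erase (a, b)) i j ↔ ¬ (i = a ∧ j = b) ∧ plusAt P i j := by
  simp only [plusAt, Finset.mem_erase]
  constructor
  · rintro ⟨⟨c, d⟩, ⟨h1, h2⟩, rfl, rfl⟩
    refine ⟨?_, _, h2, rfl, rfl⟩
    rintro ⟨h3, h4⟩
    exact h1 (Prod.ext (Fin.ext h3) (Fin.ext h4))
  · rintro ⟨h, ⟨c, d⟩, h2, rfl, rfl⟩
    refine ⟨_, ⟨?_, h2⟩, rfl, rfl⟩
    rintro h3
    simp only [Prod.mk.injEq] at h3
    exact h ⟨by rw [h3.1], by rw [h3.2]⟩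

theorem gridMove_of_move {n : ℕ} {P P' : Config n} (h : Move P P' ∨ KMove P P') :
    ∃ i j, plusAt P (i + 1) (j + 1) ∧ GridMove i j (plusAt P) (plusAt P') := by
  rcases h with ⟨i, i', j, j', ⟨hi, hj, h1, h2, h3, h4⟩, rfl⟩ |
    ⟨i, i', j, j', ⟨hi, hj, h1, h2, h3, h4⟩, rfl⟩ <;>
  rw [← plusAt_val] at h1 h2 h3 h4 <;> rw [hi] at h3 h4 <;> rw [hj] at h2 h4 <;>
  refine ⟨i, j, h4, h1, h2, h3, h4, plusAt_insert.mpr (.inl ⟨rfl, rfl⟩), fun a b n1 n2 => ?_⟩ <;>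
  simp only [plusAt_insert, plusAt_erase, n1, hi, hj, n2, false_or, not_false_eq_true, true_and]

theorem mem_pipe_iff_gridValid {n q : ℕ} {w : Perm (Fin n)} {A : ℕ → Prop}
    (hw : ∀ i j, plusAt (rothe w) i j ↔ gridRothe n q A i j) (hq : countBelow A n = q)
    {P : Config n} : P ∈ Pipe q w ↔ GridValid n q A (fun _ => False) (plusAt P) := by
  rw [mem_pipe]
  have hw' : plusAt (rothe w) = gridRothe n q A := by
    funext i j; exact propext (hw i j)
  constructor
  · intro h
    induction h with
    | refl => rw [hw']; exact gridValid_gridRothe hq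
    | tail _ h ih =>
      obtain ⟨i, j, h1, h2⟩ := gridMove_of_move h.1
      have := ih.bound _ _ h1
      exact (h2.gridValid_iff this.1 this.2).mpr ih
  · intro h
    induction hm : ∑ a ∈ P, (n - a.1 : ℕ) using Nat.strong_induction_on generalizing P with
    | _ m ih =>
    by_cases hP : ∀ i j, plusAt P i j ↔ gridRothe n q A i j
    · rw [config_ext fun i j => (hP i j).trans (hw i j).symm]
    obtain ⟨i, j, hi, hj, h1, h2, h3⟩ := h.exists_back hP
    obtain ⟨-, hjn⟩ := plusAt_lt h1
    have hjn' : j + 1 < n := by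
      have := h.bound
      by_contra hjn'
      obtain rfl : n = j + 1 := by omega
      have e : countBelow A (j + 1) ≤ j + 1 := by
        classical
        exact (Finset.card_filter_le _ _).trans (by simp)
      omega
    have hin : i < n := by omega
    let ul : Fin n × Fin n := (⟨i, hin⟩, ⟨j, hjn⟩)
    let lr : Fin n × Fin n := (⟨i + 1, hi⟩, ⟨j + 1, hjn'⟩)
    have hul : ul ∈ P := (plusAt_mk hin hjn).mp h1
    have hne : ul ≠ lr := by simp [ul, lr]
    have hexc : IsExcitable (insert lr (P.erase ul)) ⟨i, hin⟩ ⟨i + 1, hi⟩ ⟨j, hjn⟩ ⟨j + 1, hjn'⟩ := by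
      refine ⟨rfl, rfl, ?_, ?_, ?_, Finset.mem_insert_self _ _⟩
      · simp [ul, lr]
      · rw [plusAt_mk hin hjn'] at h2
        simp [lr, h2]
      · rw [plusAt_mk hi hjn] at h3
        simp [lr, h3]
    have hmove : Move (insert lr (P.erase ul)) P ∨ KMove (insert lr (P.erase ul)) P := by
      by_cases hlr : lr ∈ P
      · refine .inr ⟨_, _, _, _, hexc, ?_⟩
        change P = insert ul (insert lr (P.erase ul))
        rw [Finset.insert_eq_self.mpr (Finset.mem_erase.mpr ⟨hne.symm, hlr⟩),
          Finset.insert_erase hul]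
      · refine .inl ⟨_, _, _, _, hexc, ?_⟩
        change P = insert ul ((insert lr (P.erase ul)).erase lr)
        rw [Finset.erase_insert (fun h => hlr (Finset.mem_of_mem_erase h)), Finset.insert_erase hul]
    have hgm : GridMove i j (plusAt (insert lr (P.erase ul))) (plusAt P) := by
      refine ⟨?_, ?_, ?_, ?_, h1, fun a b n1 n2 => ?_⟩
      all_goals simp only [plusAt_insert, plusAt_erase, ul, lr]
      · simp
      · simp [h2]
      · simp [h3]
      · simp
      · simp [n1, n2]
    have hsum : (n - i) + ∑ a ∈ P.erase ul, (n - a.1 : ℕ) = ∑ a ∈ P, (n - a.1 : ℕ) :=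
      Finset.add_sum_erase P (fun a => (n - a.1 : ℕ)) hul
    refine (ih _ ?_ ((hgm.gridValid_iff hi hj).mp h) rfl).tail ⟨hmove, fun a ha => ?_⟩
    · have hle : ∑ a ∈ insert lr (P.erase ul), (n - a.1 : ℕ) ≤
          (n - (i + 1)) + ∑ a ∈ P.erase ul, (n - a.1 : ℕ) := by
        by_cases hlr : lr ∈ P.erase ul
        · rw [Finset.insert_eq_self.mpr hlr]; omega
        · rw [Finset.sum_insert hlr]
      omega
    · exact (h.bound a.1 a.2 ⟨a, ha, rfl, rfl⟩).2

/-! ### The partition function as a sum over pipe diagrams -/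

/-- The crossings of `Q`, as a relation on natural numbers. -/
def gridOf {n q : ℕ} (Q : Fin n → Fin q → Bool) (i j : ℕ) : Prop :=
  ∃ (hi : i < n) (hj : j < q), Q ⟨i, hi⟩ ⟨j, hj⟩ = true

theorem gridOf_tail {n q : ℕ} (Q : Fin (n + 1) → Fin q → Bool) (i j : ℕ) :
    gridOf (Fin.tail Q) i j ↔ gridOf Q (i + 1) j := by
  simp [gridOf, Fin.tail]

theorem gridV_shift (T : ℕ → Prop) (P : ℕ → ℕ → Prop) (i j : ℕ) :
    gridV T P (i + 1) j ↔ gridV (gridV T P 1) (fun a => P (a + 1)) i j := by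
  induction i generalizing j with
  | zero => rfl
  | succ i ih =>
    rcases j with _ | j
    · simp [gridV]
    · simp only [gridV] at ih ⊢
      rw [ih]

theorem gridH_shift (T : ℕ → Prop) (P : ℕ → ℕ → Prop) (i j : ℕ) :
    gridH T P (i + 1) j ↔ gridH (gridV T P 1) (fun a => P (a + 1)) i j := by
  rcases j with _ | j
  · rfl
  · rw [gridH_succ, gridH_succ, gridV_shift]

theorem gridValid_succ_iff {n q : ℕ} {A T : ℕ → Prop} {P : ℕ → ℕ → Prop} :
    GridValid (n + 1) q A T P ↔
      (∀ j, P 0 j → j < q ∧ (T j ↔ ¬ gridH T P 0 j)) ∧ (gridH T P 0 q ↔ ¬ A 0) ∧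
        GridValid n q (fun i => A (i + 1)) (gridV T P 1) (fun i => P (i + 1)) := by
  constructor
  · intro h
    refine ⟨fun j hj => ⟨(h.bound 0 j hj).2, h.cross 0 j hj⟩, h.right 0 (by omega),
      fun i j hij => ?_, fun i j hij => ?_, fun i hi => ?_, fun j hj => ?_⟩
    · have := h.bound _ _ hij; omega
    · rw [← gridV_shift, ← gridH_shift]; exact h.cross _ _ hij
    · rw [← gridH_shift]; exact h.right _ (by omega)
    · rw [← gridV_shift]; exact h.bottom _ hj
  · rintro ⟨h1, h2, h⟩
    refine ⟨fun i j hij => ?_, fun i j hij => ?_, fun i hi => ?_, fun j hj => ?_⟩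
    · rcases i with _ | i
      · exact ⟨by omega, (h1 j hij).1⟩
      · have := h.bound i j hij; omega
    · rcases i with _ | i
      · exact (h1 j hij).2
      · rw [gridV_shift, gridH_shift]; exact h.cross i j hij
    · rcases i with _ | i
      · exact h2
      · rw [gridH_shift]; exact h.right i (by omega)
    · rw [gridV_shift]; exact h.bottom j hj

theorem admissible_iff_gridValid {n q : ℕ} (ε : Fin n → Bool) (A T : ℕ → Prop) (t : Fin q → Bool)
    (Q : Fin n → Fin q → Bool) (hε : ∀ i : Fin n, ε i = true ↔ ¬ A i)
    (ht : ∀ j : Fin q, t j = true ↔ T j) :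
    Admissible n ε t Q ↔ GridValid n q A T (gridOf Q) := by
  induction n generalizing A T t with
  | zero =>
    constructor
    · intro h
      refine ⟨fun i j h => ?_, fun i j h => ?_, fun i h => ?_, fun j hj => ?_⟩
      · obtain ⟨h, -⟩ := h; omega
      · obtain ⟨h, -⟩ := h; omega
      · omega
      · exact (ht ⟨j, hj⟩).mp (congrFun h _)
    · intro h
      funext j
      exact (ht j).mpr (h.bottom j j.2)
  | succ n ih =>
    have hQ : ∀ j : Fin q, gridOf Q 0 j ↔ Q 0 j = true := by
      intro j; simp [gridOf]
    have hH : ∀ k : Fin (q + 1), hor true t (Q 0) k = true ↔ gridH T (gridOf Q) 0 k := by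
      intro k
      refine Fin.cases ?_ (fun j => ?_) k
      · simp [hor, gridH]
      · rw [Fin.val_succ, gridH_succ, hQ]
        simp [hor, gridV, ht]
    have hV : ∀ j : Fin q, down true t (Q 0) j = true ↔ gridV T (gridOf Q) 1 j := by
      intro j
      rw [gridV_succ, hQ]
      have := hH j.castSucc
      simp only [Fin.val_castSucc] at this
      simp [down, this]
    rw [Admissible, gridValid_succ_iff, ih (Fin.tail ε) (fun i => A (i + 1)) (gridV T (gridOf Q) 1) _ _
      (fun i => hε i.succ) hV]
    have hg : gridOf (Fin.tail Q) = fun i => gridOf Q (i + 1) := by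
      funext i j; exact propext (gridOf_tail Q i j)
    rw [hg, RowValid, ← and_assoc]
    refine and_congr_left' (and_congr ?_ ?_)
    · constructor
      · rintro h j hj
        obtain ⟨_, hjq, hj'⟩ := hj
        refine ⟨hjq, ?_⟩
        have h1 := h ⟨j, hjq⟩ hj'
        have h2 := hH (Fin.castSucc ⟨j, hjq⟩)
        have h3 := ht ⟨j, hjq⟩
        simp only [Fin.val_castSucc] at h2 h3
        rw [← h2, ← h3]
        revert h1
        cases t ⟨j, hjq⟩ <;> cases hor true t (Q 0) (Fin.castSucc ⟨j, hjq⟩) <;> simp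
      · intro h j hj e
        have h1 := (h j ((hQ j).mpr hj)).2
        have h2 := hH j.castSucc
        simp only [Fin.val_castSucc] at h2
        rw [← h2, ← ht, e] at h1
        tauto
    · have h1 := hH (Fin.last q)
      have h2 := hε 0
      simp only [Fin.val_last] at h1
      simp only [Fin.val_zero] at h2
      rw [← h1, ← h2]
      cases hor true t (Q 0) (Fin.last q) <;> cases ε 0 <;> simp

/-- The configuration in the `n × n` grid with the crossings of `Q`. -/
def toConfig {n q : ℕ} (hq : q ≤ n) (Q : Fin n → Fin q → Bool) : Config n :=
  (Finset.univ.filter fun a : Fin n × Fin q => Q a.1 a.2 = true).map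
    ((Function.Embedding.refl _).prodMap (Fin.castLEEmb hq))

theorem plusAt_toConfig {n q : ℕ} (hq : q ≤ n) (Q : Fin n → Fin q → Bool) :
    plusAt (toConfig hq Q) = gridOf Q := by
  funext i j
  refine propext ⟨?_, ?_⟩
  · rintro ⟨a, ha, rfl, rfl⟩
    obtain ⟨⟨c, d⟩, hc, rfl⟩ := Finset.mem_map.mp ha
    exact ⟨c.2, d.2, (Finset.mem_filter.mp hc).2⟩
  · rintro ⟨hi, hj, h⟩
    exact ⟨_, Finset.mem_map_of_mem _ (Finset.mem_filter.mpr
      ⟨Finset.mem_univ (⟨⟨i, hi⟩, ⟨j, hj⟩⟩ : Fin n × Fin q), h⟩), rfl, rfl⟩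

theorem partitionSum_eq_sum_pipe {R : Type*} [CommRing R] {n q : ℕ} (hqn : q ≤ n)
    {w : Perm (Fin n)} {A : ℕ → Prop}
    (hw : ∀ i j, plusAt (rothe w) i j ↔ gridRothe n q A i j) (hq : countBelow A n = q)
    (X Y : ℕ → R) (ε : Fin n → Bool) (hε : ∀ i : Fin n, ε i = true ↔ ¬ A i) :
    partitionSum (fun j : Fin q => Y j) n (fun i => X i) ε (fun _ => false) =
      ∑ P ∈ Pipe q w, ∏ a ∈ P, (X a.1 * Y a.2 - 1) := by
  classical
  rw [partitionSum_eq_sum, ← Finset.sum_filter]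
  have hadm : ∀ Q : Fin n → Fin q → Bool, Admissible n ε (fun _ => false) Q ↔
      toConfig hqn Q ∈ Pipe q w := fun Q => by
    rw [mem_pipe_iff_gridValid hw hq, plusAt_toConfig]
    exact admissible_iff_gridValid ε A _ _ Q hε (by simp)
  refine Finset.sum_bij (fun Q _ => toConfig hqn Q) (fun Q hQ => ?_) (fun Q _ Q' _ h => ?_)
    (fun P hP => ?_) (fun Q _ => ?_)
  · exact (hadm Q).mp (Finset.mem_filter.mp hQ).2
  · have h' := congrArg plusAt h
    simp only [plusAt_toConfig] at h'
    funext i j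
    have := congrFun (congrFun h' i) j
    simp only [gridOf, Fin.is_lt, exists_true_left, Fin.eta, eq_iff_iff] at this
    exact Bool.eq_iff_iff.mpr this
  · have hv := (mem_pipe_iff_gridValid hw hq).mp hP
    have key : toConfig hqn (fun i j => decide ((i, Fin.castLE hqn j) ∈ P)) = P := by
      refine config_ext fun i j => ?_
      rw [plusAt_toConfig]
      constructor
      · rintro ⟨hi, hj, h⟩
        exact ⟨_, of_decide_eq_true h, rfl, rfl⟩
      · intro h
        obtain ⟨hi, hj⟩ := hv.bound i j h
        obtain ⟨hi', hj'⟩ := plusAt_lt h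
        exact ⟨hi, hj, decide_eq_true ((plusAt_mk hi hj').mp h)⟩
    refine ⟨_, Finset.mem_filter.mpr ⟨Finset.mem_univ _, (hadm _).mpr ?_⟩, key⟩
    rwa [key]
  · rw [toConfig, Finset.prod_map, Finset.prod_filter, Fintype.prod_prod_type]
    rfl

/-! ### Shuffles -/

/-- The predicate on natural numbers that belongs to a subset of `Fin n`. -/
def memVal {n : ℕ} (A : Finset (Fin n)) (k : ℕ) : Prop := ∃ a ∈ A, (a : ℕ) = k

theorem memVal_val {n : ℕ} {A : Finset (Fin n)} {k : Fin n} : memVal A k ↔ k ∈ A :=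
  ⟨fun ⟨_, ha, h⟩ => Fin.ext h ▸ ha, fun h => ⟨k, h, rfl⟩⟩

theorem countBelow_memVal {n : ℕ} (A : Finset (Fin n)) (k : ℕ) :
    countBelow (memVal A) k = (A.filter fun a : Fin n => (a : ℕ) < k).card := by
  classical
  rw [countBelow, ← Finset.card_map Fin.valEmbedding]
  congr 1
  ext m
  simp only [Finset.mem_filter, Finset.mem_range, Finset.mem_map, memVal, Fin.valEmbedding_apply]
  constructor
  · rintro ⟨h, a, ha, rfl⟩; exact ⟨a, ⟨ha, h⟩, rfl⟩
  · rintro ⟨a, ⟨ha, h⟩, rfl⟩; exact ⟨h, a, ha, rfl⟩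

theorem countBelow_memVal_self {n : ℕ} (A : Finset (Fin n)) :
    countBelow (memVal A) n = A.card := by
  rw [countBelow_memVal, Finset.filter_true_of_mem fun a _ => a.2]

namespace Clan

variable {n : ℕ} {A : Finset (Fin n)}

theorem shuffle_val (A : Finset (Fin n)) (i : Fin n) : (shuffle A i : ℕ) = label A i := rfl

theorem shuffle_of_mem {i : Fin n} (h : i ∈ A) :
    (shuffle A i : ℕ) = (A.filter (· < i)).card := by
  simp [shuffle_val, label, h]

theorem shuffle_of_notMem {i : Fin n} (h : i ∉ A) :
    (shuffle A i : ℕ) = A.card + (Aᶜ.filter (· < i)).card := by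
  simp [shuffle_val, label, h]

theorem shuffle_lt_card {i : Fin n} (h : i ∈ A) : (shuffle A i : ℕ) < A.card := by
  rw [shuffle_of_mem h]; exact card_filter_lt h

theorem card_le_shuffle {i : Fin n} (h : i ∉ A) : A.card ≤ shuffle A i := by
  rw [shuffle_of_notMem h]; omega

theorem shuffle_lt_of_mem {i j : Fin n} (hi : i ∈ A) (hj : j ∈ A) (h : i < j) :
    shuffle A i < shuffle A j := by
  rw [Fin.lt_def, shuffle_of_mem hi, shuffle_of_mem hj]; exact card_filter_lt_lt hi h

theorem shuffle_lt_of_notMem {i j : Fin n} (hi : i ∉ A) (hj : j ∉ A) (h : i < j) :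
    shuffle A i < shuffle A j := by
  rw [Fin.lt_def, shuffle_of_notMem hi, shuffle_of_notMem hj]
  have := card_filter_lt_lt (Finset.mem_compl.mpr hi) h
  omega

theorem plusAt_rothe_shuffle (A : Finset (Fin n)) (i j : ℕ) :
    plusAt (rothe (shuffle A)) i j ↔ gridRothe n A.card (memVal A) i j := by
  by_cases hij : i < n ∧ j < n
  swap
  · refine ⟨fun h => absurd (plusAt_lt h) hij, fun h => absurd ⟨h.1, ?_⟩ hij⟩
    have h1 := h.2.1
    have h2 : A.card ≤ n := by simpa using Finset.card_le_univ A
    omega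
  obtain ⟨hi, hj⟩ := hij
  rw [plusAt_mk hi hj]
  have e1 : memVal A i ↔ (⟨i, hi⟩ : Fin n) ∈ A := memVal_val (k := ⟨i, hi⟩)
  have e2 : countBelow (memVal A) i = (A.filter (· < (⟨i, hi⟩ : Fin n))).card :=
    countBelow_memVal A i
  obtain ⟨m, hm⟩ := (shuffle A).surjective ⟨j, hj⟩
  have hmj : (shuffle A m : ℕ) = j := by rw [hm]
  rw [← hm, mem_rothe, gridRothe, e1, e2]
  generalize (⟨i, hi⟩ : Fin n) = k
  simp only [hi, true_and]
  by_cases hk : k ∈ A <;> by_cases hmA : m ∈ A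
  · simp only [hk, not_true_eq_false, false_and, and_false, iff_false, not_and]
    exact fun h1 h2 => absurd h1 (shuffle_lt_of_mem hk hmA h2).not_gt
  · simp only [hk, not_true_eq_false, false_and, and_false, iff_false, not_and]
    have h1 := shuffle_lt_card hk
    have h2 := card_le_shuffle hmA
    intro h; rw [Fin.lt_def] at h; omega
  · have h1 := shuffle_lt_card hmA
    have h2 := card_le_shuffle hk
    have h3 := shuffle_of_mem hmA
    have hlt : shuffle A m < shuffle A k := by rw [Fin.lt_def]; omega
    simp only [hk, not_false_eq_true, true_and, hlt]
    constructor
    · intro h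
      refine ⟨by omega, ?_⟩
      rw [← hmj, h3]
      exact Finset.card_le_card fun a ha => by
        simp only [Finset.mem_filter] at ha ⊢
        exact ⟨ha.1, ha.2.trans h⟩
    · rintro ⟨-, h⟩
      by_contra hle
      have hne : m ≠ k := fun e => hk (e ▸ hmA)
      have := card_filter_lt_lt hmA (lt_of_le_of_ne (not_lt.mp hle) hne)
      omega
  · have h1 := card_le_shuffle hmA
    constructor
    · exact fun h => absurd h.1 (shuffle_lt_of_notMem hk hmA h.2).not_gt
    · intro h; omega

theorem card_filter_simpleRefl {i : ℕ} (h : i + 1 < n) (B B' : Finset (Fin n))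
    (hB : ∀ k, k ∈ B' ↔ simpleRefl n i k ∈ B)
    (hnot : ¬ ((⟨i, by omega⟩ : Fin n) ∈ B ∧ (⟨i + 1, h⟩ : Fin n) ∈ B)) {k : Fin n} (hk : k ∈ B') :
    (B'.filter (· < k)).card = (B.filter (· < simpleRefl n i k)).card := by
  rw [← Finset.card_map (simpleRefl n i).toEmbedding (s := B'.filter (· < k))]
  congr 1
  ext m
  rw [Finset.mem_map_equiv, simpleRefl_symm, Finset.mem_filter, Finset.mem_filter, hB,
    simpleRefl_simpleRefl]
  rw [hB] at hk
  refine and_congr_right fun hm => ?_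
  have hne : ∀ a : Fin n, ∀ b, ∀ hb : b < n, (a : ℕ) = b → a = ⟨b, hb⟩ := fun a b hb e => Fin.ext e
  have k1 := hne k i (by omega)
  have k2 := hne k (i + 1) (by omega)
  have m1 := hne m i (by omega)
  have m2 := hne m (i + 1) (by omega)
  simp only [Fin.lt_def]
  rw [simpleRefl_apply h k] at hk ⊢
  rw [simpleRefl_apply h m]
  grind

theorem shuffle_mul_simpleRefl {i : ℕ} (h : i + 1 < n) (A A' : Finset (Fin n))
    (hA : ∀ k, k ∈ A' ↔ simpleRefl n i k ∈ A)
    (h0 : (⟨i, by omega⟩ : Fin n) ∈ A) (h1 : (⟨i + 1, h⟩ : Fin n) ∉ A) :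
    shuffle A * simpleRefl n i = shuffle A' := by
  have hcard : A'.card = A.card := by
    rw [← Finset.card_map (simpleRefl n i).toEmbedding (s := A')]
    congr 1
    ext m
    rw [Finset.mem_map_equiv, simpleRefl_symm, hA, simpleRefl_simpleRefl]
  ext k
  rw [Perm.mul_apply]
  by_cases hk : k ∈ A'
  · rw [shuffle_of_mem hk, shuffle_of_mem ((hA k).mp hk),
      card_filter_simpleRefl h A A' hA (fun h => h1 h.2) hk]
  · rw [shuffle_of_notMem hk, shuffle_of_notMem (fun h => hk ((hA k).mpr h)), hcard,
      card_filter_simpleRefl h Aᶜ A'ᶜ (fun k => by simp [hA])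
        (fun h => Finset.mem_compl.mp h.1 h0) (Finset.mem_compl.mpr hk)]

theorem dominant_shuffle (hA : ∀ i j : Fin n, i ∈ A → i < j → j ∈ A) : Dominant (shuffle A) := by
  intro a b c hab hbc h1 h2
  by_cases ha : a ∈ A
  · have hb := hA a b ha hab
    exact h2.not_gt (shuffle_lt_of_mem hb (hA b c hb hbc) hbc)
  · have hc : c ∉ A := fun hc => by
      have := shuffle_lt_card hc
      have := card_le_shuffle ha
      rw [Fin.lt_def] at h1; omega
    exact h2.not_gt (shuffle_lt_of_notMem (fun hb => hc (hA b c hb hbc)) hc hbc)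

end Clan

open Clan

theorem beta_ne_zero : β ≠ 0 := by
  unfold β
  rw [Ne, MvPolynomial.C_eq_zero]
  exact Polynomial.X_ne_zero

theorem betaSchubert_shuffle_eq_partitionSum {n q : ℕ} (A : Finset (Fin n)) (hq : A.card = q) :
    (-β) ^ (rothe (shuffle A)).card * betaSchubert (shuffle A) =
      partitionSum (fun j : Fin q => 1 + β * y j) n (fun i => 1 - β * x i) (fun i => decide (i ∉ A))
        (fun _ => false) := by
  induction hm : weightedSum (shuffle A) using Nat.strong_induction_on generalizing A with
  | _ m ih =>
  by_cases hup : ∃ i, ∃ h : i + 1 < n, (⟨i, by omega⟩ : Fin n) ∈ A ∧ (⟨i + 1, h⟩ : Fin n) ∉ A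
  · obtain ⟨i, h, h0, h1⟩ := hup
    set A' := A.map (simpleRefl n i).toEmbedding with hA'
    have hmem : ∀ k, k ∈ A' ↔ simpleRefl n i k ∈ A := fun k => by
      rw [hA', Finset.mem_map_equiv, simpleRefl_symm]
    have hlt : shuffle A ⟨i, by omega⟩ < shuffle A ⟨i + 1, h⟩ := by
      have := shuffle_lt_card h0
      have := card_le_shuffle h1
      rw [Fin.lt_def]; omega
    have hasc : IsAscent (shuffle A) i := ⟨h, hlt⟩
    have hs := shuffle_mul_simpleRefl h A A' hmem h0 h1
    have ih' := ih _ (by rw [← hm, ← hs]; exact weightedSum_lt hasc) A'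
      (by rw [hA', Finset.card_map, hq]) rfl
    rw [← hs, card_rothe_mul_simpleRefl h hlt] at ih'
    have hsw := congrArg (swapX i) ih'
    have hmap := map_partitionSum (swapX i).toRingHom (fun j : Fin q => 1 + β * y j) n
      (fun i => 1 - β * x i) (fun i => decide (i ∉ A')) (fun _ => false)
    simp only [AlgHom.toRingHom_eq_coe, RingHom.coe_coe] at hmap
    rw [hmap] at hsw
    have hY : ((swapX i) ∘ fun j : Fin q => 1 + β * y j) = fun j : Fin q => 1 + β * y j := by
      funext j; simp [swapX_beta, swapX_y]
    rw [hY] at hsw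
    simp only [map_mul, map_pow, map_neg, swapX_beta] at hsw
    have hex := partitionSum_exchange (fun j : Fin q => 1 + β * y j) n (fun i => 1 - β * x i)
      ((swapX i) ∘ fun i : Fin n => 1 - β * x i) (fun i => decide (i ∉ A))
      (fun i => decide (i ∉ A')) (fun _ => false) i h (by
        intro k
        simp only [Function.comp, map_sub, map_one, map_mul, swapX_beta, swapX_x h,
          simpleRefl_apply h]
        split_ifs <;> rfl) (by
        intro k
        simp only [hmem, simpleRefl_apply h]
        split_ifs
        · simp [h1]
        · simp [h0]
        · rfl) (by simp [h0]) (by simp [h1])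
    have hspec := betaDivDiff_spec i (betaSchubert (shuffle A * simpleRefl n i))
    rw [← betaSchubert_of_isAscent _ hasc] at hspec
    simp only at hex
    rw [← ih', ← hsw] at hex
    apply mul_left_cancel₀ (mul_ne_zero (neg_ne_zero.mpr beta_ne_zero)
      (x_sub_x_ne_zero (show i ≠ i + 1 by omega)))
    linear_combination (-β) ^ ((rothe (shuffle A)).card + 1) * hspec - hex
  · have hup' : ∀ i j : Fin n, i ∈ A → i < j → j ∈ A := by
      push Not at hup
      intro i j hi hij
      have : ∀ k, (i : ℕ) ≤ k → ∀ hk : k < n, (⟨k, hk⟩ : Fin n) ∈ A := by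
        intro k hk
        induction k, hk using Nat.le_induction with
        | base => exact fun _ => hi
        | succ k hk ih => exact fun hkn => hup k hkn (ih (by omega))
      exact this j hij.le j.2
    have hd := dominant_shuffle hup'
    have hqn : q ≤ n := by rw [← hq]; simpa using Finset.card_le_univ A
    have := partitionSum_eq_sum_pipe hqn (w := shuffle A) (A := memVal A)
      (fun i j => by rw [plusAt_rothe_shuffle, hq]) (by rw [countBelow_memVal_self, hq])
      (fun i => 1 - β * x i) (fun j => 1 + β * y j) (fun i => decide (i ∉ A))
      (fun i => by simp [memVal_val])
    rw [this, hd.pipe_eq, Finset.sum_singleton, betaSchubert_of_dominant _ hd,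
      ← Finset.prod_const, ← Finset.prod_mul_distrib]
    exact Finset.prod_congr rfl fun a _ => by ring

theorem betaSchubert_shuffle {n q : ℕ} (A : Finset (Fin n)) (hq : A.card = q) :
    betaSchubert (shuffle A) = ∑ P ∈ Pipe q (shuffle A), betaWeight (shuffle A) P := by
  have h := betaSchubert_shuffle_eq_partitionSum A hq
  have hqn : q ≤ n := by rw [← hq]; simpa using Finset.card_le_univ A
  rw [partitionSum_eq_sum_pipe hqn (w := shuffle A) (A := memVal A)
      (fun i j => by rw [plusAt_rothe_shuffle, hq]) (by rw [countBelow_memVal_self, hq])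
      (fun i => 1 - β * x i) (fun j => 1 + β * y j) (fun i => decide (i ∉ A))
      (fun i => by simp [memVal_val])] at h
  apply mul_left_cancel₀ (pow_ne_zero (rothe (shuffle A)).card (neg_ne_zero.mpr beta_ne_zero))
  rw [h, Finset.mul_sum]
  refine Finset.sum_congr rfl fun P hP => ?_
  rw [betaWeight, ← mul_assoc, ← pow_add, Nat.add_sub_cancel' (card_le_of_mem_pipe hP),
    ← Finset.prod_const, ← Finset.prod_mul_distrib]
  exact Finset.prod_congr rfl fun a _ => by ring

theorem map_betaWeight {n : ℕ} {w : Perm (Fin n)} {P : Config n}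
    (hP : (rothe w).card ≤ P.card) :
    MvPolynomial.map (Polynomial.evalRingHom 0) (betaWeight w P) =
      if P.card = (rothe w).card then weight P else 0 := by
  have hβ : MvPolynomial.map (Polynomial.evalRingHom 0) β = (0 : MvPolynomial (ℕ ⊕ ℕ) ℤ) := by
    simp [β]
  rw [betaWeight, map_mul, map_pow, map_neg, hβ, map_prod, neg_zero]
  split_ifs with h
  · rw [h, Nat.sub_self, pow_zero, one_mul, weight]
    exact Finset.prod_congr rfl fun a _ => by simp [hβ, x, y]
  · rw [zero_pow (by omega), zero_mul]

theorem doubleSchubert_shuffle {n q : ℕ} (A : Finset (Fin n)) (hq : A.card = q) :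
    doubleSchubert (shuffle A) = ∑ P ∈ ReducedPipe q (shuffle A), weight P := by
  classical
  rw [doubleSchubert, betaSchubert_shuffle A hq, map_sum,
    Finset.sum_congr rfl fun P hP => map_betaWeight (card_le_of_mem_pipe hP), ← Finset.sum_filter]
  refine Finset.sum_congr ?_ fun _ _ => rfl
  ext P
  rw [Finset.mem_filter, mem_reducedPipe_iff_card]

/-! ### Set-valued tableaux and pipe diagrams -/

namespace FlaggedSetTableau

variable {μ : YoungDiagram} {f : ℕ → ℕ}

theorem mem_shape (T : FlaggedSetTableau μ f) {a r c : ℕ} (h : a ∈ T.entry r c) : (r, c) ∈ μ := by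
  by_contra hc
  rw [T.entry_eq_empty r c hc] at h
  simp at h

theorem row_le (T : FlaggedSetTableau μ f) {a b r c c' : ℕ} (hc : c < c') (ha : a ∈ T.entry r c)
    (hb : b ∈ T.entry r c') : a ≤ b := T.row_weak r c c' hc a ha b hb

theorem col_lt (T : FlaggedSetTableau μ f) {a b r r' c : ℕ} (hr : r < r') (ha : a ∈ T.entry r c)
    (hb : b ∈ T.entry r' c) : a < b := T.col_strict r r' c hr a ha b hb

theorem lt_of_northwest (T : FlaggedSetTableau μ f) {a b r r' c c' : ℕ} (hr : r < r') (hc : c ≤ c')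
    (ha : a ∈ T.entry r c) (hb : b ∈ T.entry r' c') : a < b := by
  rcases hc.eq_or_lt with rfl | hc
  · exact T.col_lt hr ha hb
  · obtain ⟨u, hu⟩ := T.entry_nonempty r c' (μ.up_left_mem hr.le le_rfl (T.mem_shape hb))
    exact (T.row_le hc ha hu).trans_lt (T.col_lt hr hu hb)

theorem eq_of_diagonal (T : FlaggedSetTableau μ f) {a r r' c c' : ℕ} (h : c + r' = c' + r)
    (ha : a ∈ T.entry r c) (ha' : a ∈ T.entry r' c') : r = r' ∧ c = c' := by
  rcases lt_trichotomy r r' with hr | hr | hr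
  · exact absurd (T.lt_of_northwest hr (by omega) ha ha') (lt_irrefl a)
  · omega
  · exact absurd (T.lt_of_northwest hr (by omega) ha' ha) (lt_irrefl a)

theorem row_le_entry (T : FlaggedSetTableau μ f) {a r c : ℕ} (h : a ∈ T.entry r c) : r ≤ a := by
  induction r generalizing a with
  | zero => omega
  | succ r ih =>
    obtain ⟨u, hu⟩ := T.entry_nonempty r c (μ.up_left_mem (Nat.le_succ r) le_rfl (T.mem_shape h))
    have := ih hu
    have := T.col_lt (Nat.lt_succ_self r) hu h
    omega

/-- Replace the set in the box `(r, c)` by `S`. -/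
def update (T : FlaggedSetTableau μ f) (r c : ℕ) (S : Finset ℕ) (hrc : (r, c) ∈ μ)
    (hS : S.Nonempty) (hleft : ∀ j < c, ∀ a ∈ T.entry r j, ∀ b ∈ S, a ≤ b)
    (hright : ∀ j, c < j → ∀ a ∈ T.entry r j, ∀ b ∈ S, b ≤ a)
    (hup : ∀ i < r, ∀ a ∈ T.entry i c, ∀ b ∈ S, a < b)
    (hdown : ∀ i, r < i → ∀ a ∈ T.entry i c, ∀ b ∈ S, b < a)
    (hflag : ∀ a ∈ S, a ≤ f r) : FlaggedSetTableau μ f where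
  entry i j := if i = r ∧ j = c then S else T.entry i j
  entry_eq_empty i j h := by
    rw [if_neg (by rintro ⟨rfl, rfl⟩; exact h hrc), T.entry_eq_empty i j h]
  entry_nonempty i j h := by
    split_ifs
    · exact hS
    · exact T.entry_nonempty i j h
  row_weak i j₁ j₂ h a ha b hb := by
    split_ifs at ha hb with h1 h2 h2
    · omega
    · obtain ⟨rfl, rfl⟩ := h1; exact hright _ h b hb a ha
    · obtain ⟨rfl, rfl⟩ := h2; exact hleft _ h a ha b hb
    · exact T.row_le h ha hb
  col_strict i₁ i₂ j h a ha b hb := by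
    split_ifs at ha hb with h1 h2 h2
    · omega
    · obtain ⟨rfl, rfl⟩ := h1; exact hdown _ h b hb a ha
    · obtain ⟨rfl, rfl⟩ := h2; exact hup _ h a ha b hb
    · exact T.col_lt h ha hb
  flagged i j a ha := by
    split_ifs at ha with h1
    · rw [h1.1]; exact hflag a ha
    · exact T.flagged i j a ha

/-- There is an entry `i` in a box of content `j - i`. -/
def At (T : FlaggedSetTableau μ f) (i j : ℕ) : Prop := ∃ r c, i ∈ T.entry r c ∧ i + c = j + r

theorem at_iff_of_update {T T' : FlaggedSetTableau μ f} {r c : ℕ}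
    (h : ∀ i j, ¬ (i = r ∧ j = c) → T'.entry i j = T.entry i j) (a b : ℕ) :
    T'.At a b ↔ (a ∈ T'.entry r c ∧ a + c = b + r) ∨
      (T.At a b ∧ ¬ (a ∈ T.entry r c ∧ a + c = b + r)) := by
  constructor
  · rintro ⟨r', c', h1, h2⟩
    by_cases hc : r' = r ∧ c' = c
    · obtain ⟨rfl, rfl⟩ := hc; exact .inl ⟨h1, h2⟩
    · rw [h r' c' hc] at h1
      refine .inr ⟨⟨r', c', h1, h2⟩, fun h3 => hc ?_⟩
      exact T.eq_of_diagonal (by omega) h1 h3.1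
  · rintro (⟨h1, h2⟩ | ⟨⟨r', c', h1, h2⟩, h3⟩)
    · exact ⟨r, c, h1, h2⟩
    · have hc : ¬ (r' = r ∧ c' = c) := by rintro ⟨rfl, rfl⟩; exact h3 ⟨h1, h2⟩
      exact ⟨r', c', by rwa [h r' c' hc], h2⟩

theorem exists_insert_pred (T : FlaggedSetTableau μ f) {i j r c : ℕ} (hi : i + 1 ∈ T.entry r c)
    (hij : i + c = j + r) (h1 : ¬ T.At i (j + 1)) (h2 : ¬ T.At (i + 1) j) {S : Finset ℕ}
    (hiS : i ∈ S) (hS : S ⊆ insert i (T.entry r c)) :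
    ∃ T' : FlaggedSetTableau μ f, T'.entry r c = S ∧
      ∀ a b, ¬ (a = r ∧ b = c) → T'.entry a b = T.entry a b := by
  have hrc := T.mem_shape hi
  have hS' : ∀ b ∈ S, b = i ∨ b ∈ T.entry r c := fun b hb => Finset.mem_insert.mp (hS hb)
  refine ⟨T.update r c S hrc ⟨i, hiS⟩ ?_ ?_ ?_ ?_ ?_, if_pos ⟨rfl, rfl⟩,
    fun a b hab => if_neg hab⟩
  · intro k hk a ha b hb
    rcases hS' b hb with rfl | hb
    · have h3 := T.row_le hk ha hi
      by_contra hlt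
      obtain rfl : a = b + 1 := by omega
      obtain ⟨u, hu⟩ := T.entry_nonempty r (c - 1) (μ.up_left_mem le_rfl (by omega) hrc)
      rcases (show k ≤ c - 1 by omega).eq_or_lt with rfl | hkc
      · exact h2 ⟨r, c - 1, ha, by omega⟩
      · have h4 := T.row_le hkc ha hu
        have h5 := T.row_le (show c - 1 < c by omega) hu hi
        obtain rfl : u = b + 1 := by omega
        exact h2 ⟨r, c - 1, hu, by omega⟩
    · exact T.row_le hk ha hb
  · intro k hk a ha b hb
    rcases hS' b hb with rfl | hb
    · have := T.row_le hk hi ha; omega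
    · exact T.row_le hk hb ha
  · intro k hk a ha b hb
    rcases hS' b hb with rfl | hb
    · have h3 := T.col_lt hk ha hi
      by_contra hlt
      obtain rfl : a = b := by omega
      obtain ⟨u, hu⟩ := T.entry_nonempty (r - 1) c (μ.up_left_mem (by omega) le_rfl hrc)
      rcases (show k ≤ r - 1 by omega).eq_or_lt with rfl | hkc
      · exact h1 ⟨r - 1, c, ha, by omega⟩
      · have h4 := T.col_lt hkc ha hu
        have h5 := T.col_lt (show r - 1 < r by omega) hu hi
        omega
    · exact T.col_lt hk ha hb
  · intro k hk a ha b hb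
    rcases hS' b hb with rfl | hb
    · have := T.col_lt hk hi ha; omega
    · exact T.col_lt hk hb ha
  · intro b hb
    rcases hS' b hb with rfl | hb
    · have := T.flagged r c _ hi; omega
    · exact T.flagged r c b hb

theorem ext_of_at {T U : FlaggedSetTableau μ f} (h : ∀ i j, T.At i j ↔ U.At i j) : T = U := by
  obtain ⟨N, hN⟩ : ∃ N, ∀ r c, (r, c) ∈ μ → c ≤ N := by
    refine ⟨μ.cells.sup Prod.snd, fun r c hrc => ?_⟩
    exact Finset.le_sup (f := Prod.snd) ((YoungDiagram.mem_cells _).mpr hrc)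
  have key : ∀ (T U : FlaggedSetTableau μ f), (∀ i j, T.At i j → U.At i j) → ∀ r c,
      (∀ r' c', r' + (N - c') < r + (N - c) → T.entry r' c' = U.entry r' c') →
      T.entry r c ⊆ U.entry r c := by
    intro T U h r c ih v hv
    have hrc := T.mem_shape hv
    have hcN := hN r c hrc
    have hrv := T.row_le_entry hv
    obtain ⟨r', c', hv', e⟩ := h v (v + c - r) ⟨r, c, hv, by omega⟩
    have e' : c + r' = c' + r := by omega
    rcases lt_trichotomy r r' with hr | hr | hr
    · have hmem := U.mem_shape hv'
      have hmem' : (r, c + 1) ∈ μ := μ.up_left_mem hr.le (by omega) hmem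
      have hcN' := hN _ _ hmem'
      obtain ⟨u, hu⟩ := U.entry_nonempty r (c + 1) hmem'
      have h1 := U.lt_of_northwest hr (by omega) hu hv'
      rw [← ih r (c + 1) (by omega)] at hu
      have := T.row_le (Nat.lt_succ_self c) hv hu
      omega
    · subst hr
      obtain rfl : c = c' := by omega
      exact hv'
    · have hmem' : (r - 1, c) ∈ μ := μ.up_left_mem (by omega) le_rfl hrc
      obtain ⟨u, hu⟩ := T.entry_nonempty (r - 1) c hmem'
      have h1 := T.col_lt (show r - 1 < r by omega) hu hv
      rw [ih (r - 1) c (by omega)] at hu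
      have : v ≤ u := by
        rcases (show r' ≤ r - 1 by omega).eq_or_lt with rfl | hlt
        · exact U.row_le (by omega) hv' hu
        · exact (U.lt_of_northwest hlt (by omega) hv' hu).le
      omega
  apply FlaggedSetTableau.ext
  funext r c
  induction hm : r + (N - c) using Nat.strong_induction_on generalizing r c with
  | _ m ih =>
  subst hm
  exact Finset.Subset.antisymm
    (key T U (fun i j => (h i j).mp) r c fun r' c' hlt => ih _ hlt r' c' rfl)
    (key U T (fun i j => (h i j).mpr) r c fun r' c' hlt => (ih _ hlt r' c' rfl).symm)

/-- The tableau with the largest possible entries. -/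
def top (hf : ∀ r s, r < s → (s, 0) ∈ μ → f r < f s) : FlaggedSetTableau μ f where
  entry i j := if (i, j) ∈ μ then {f i} else ∅
  entry_eq_empty i j h := if_neg h
  entry_nonempty i j h := by rw [if_pos h]; exact Finset.singleton_nonempty _
  row_weak i j₁ j₂ _ a ha b hb := by
    split_ifs at ha hb <;> simp_all
  col_strict i₁ i₂ j h a ha b hb := by
    split_ifs at ha hb with h1 h2
    · rw [Finset.mem_singleton] at ha hb
      rw [ha, hb]
      exact hf _ _ h (μ.up_left_mem le_rfl (Nat.zero_le _) h2)
    all_goals simp_all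
  flagged i j a ha := by
    split_ifs at ha <;> simp_all

theorem mem_top {hf : ∀ r s, r < s → (s, 0) ∈ μ → f r < f s} {a r c : ℕ} :
    a ∈ (top hf).entry r c ↔ (r, c) ∈ μ ∧ a = f r := by
  change a ∈ (if (r, c) ∈ μ then {f r} else ∅) ↔ _
  split_ifs with h <;> simp [h]

/-- A tableau that is not the largest one has an entry which can be increased. -/
theorem exists_raise (hf : ∀ r s, r < s → (s, 0) ∈ μ → f r < f s) (T : FlaggedSetTableau μ f)
    (hT : T ≠ top hf) :
    ∃ r c v, v ∈ T.entry r c ∧ v < f r ∧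
      (∀ r' c' a, r < r' → a ∈ T.entry r' c' → a = f r') ∧
      (∀ c' a, c < c' → a ∈ T.entry r c' → a = f r) := by
  classical
  have hex : (μ.cells.filter fun x => ∃ v ∈ T.entry x.1 x.2, v ≠ f x.1).Nonempty := by
    by_contra hne
    rw [Finset.not_nonempty_iff_eq_empty, Finset.filter_eq_empty_iff] at hne
    refine hT (ext_of_at fun i j => ?_)
    have hall : ∀ r c a, a ∈ T.entry r c → a = f r := fun r c a ha => by
      have := hne ((YoungDiagram.mem_cells (r, c)).mpr (T.mem_shape ha))
      push Not at this
      exact this a ha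
    have hiff : ∀ r c a, a ∈ T.entry r c ↔ a ∈ (top hf).entry r c := fun r c a => by
      rw [mem_top]
      refine ⟨fun ha => ⟨T.mem_shape ha, hall r c a ha⟩, ?_⟩
      rintro ⟨hrc, rfl⟩
      obtain ⟨u, hu⟩ := T.entry_nonempty r c hrc
      rwa [← hall r c u hu]
    simp only [At, hiff]
  obtain ⟨⟨r, c⟩, hx, hmax⟩ := Finset.exists_max_image _ (fun x : ℕ × ℕ => toLex x) hex
  obtain ⟨-, v, hv, hne⟩ := Finset.mem_filter.mp hx
  have hall : ∀ r' c' a, toLex (r, c) < toLex (r', c') → a ∈ T.entry r' c' → a = f r' := by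
    intro r' c' a hlt ha
    by_contra hne'
    exact (hmax (r', c') (Finset.mem_filter.mpr
      ⟨(YoungDiagram.mem_cells _).mpr (T.mem_shape ha), a, ha, hne'⟩)).not_gt hlt
  refine ⟨r, c, v, hv, lt_of_le_of_ne (T.flagged r c v hv) hne, fun r' c' a h => ?_,
    fun c' a h => ?_⟩
  · exact hall r' c' a (Prod.Lex.toLex_lt_toLex.mpr (.inl h))
  · exact hall r c' a (Prod.Lex.toLex_lt_toLex.mpr (.inr ⟨rfl, h⟩))

end FlaggedSetTableau

/-- The Rothe diagram of `w` lies in the first `q` columns, and consists of the rows of `μ`, where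
the row `r` is placed in the row `f r` with its boxes shifted by `f r - r` to the right. -/
structure HasShape {n : ℕ} (q : ℕ) (w : Perm (Fin n)) (μ : YoungDiagram) (f : ℕ → ℕ) : Prop where
  strict : ∀ r s, r < s → (s, 0) ∈ μ → f r < f s
  rothe_iff : ∀ i j, plusAt (rothe w) i j ↔ ∃ r c, (r, c) ∈ μ ∧ i = f r ∧ i + c = j + r
  lt_of_rothe : ∀ i j, plusAt (rothe w) i j → j < q

namespace FlaggedSetTableau

variable {μ : YoungDiagram} {f : ℕ → ℕ} {n q : ℕ} {w : Perm (Fin n)}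

open Classical in
/-- The configuration with a `+` at `(v, v + c - r)` for every entry `v` of the box `(r, c)`. -/
def config (n : ℕ) (T : FlaggedSetTableau μ f) : Config n :=
  Finset.univ.filter fun a => T.At a.1 a.2

theorem mem_config {T : FlaggedSetTableau μ f} {a : Fin n × Fin n} :
    a ∈ T.config n ↔ T.At a.1 a.2 := by
  simp [config]

theorem top_at_iff (h : HasShape q w μ f) (i j : ℕ) :
    (top h.strict).At i j ↔ plusAt (rothe w) i j := by
  simp only [h.rothe_iff, At, mem_top, and_assoc]

theorem lt_of_at (h : HasShape q w μ f) (T : FlaggedSetTableau μ f) {i j : ℕ} (hT : T.At i j) :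
    i < n ∧ j < n ∧ j < q := by
  obtain ⟨r, c, h1, h2⟩ := hT
  have hrc := T.mem_shape h1
  have hf := T.flagged r c i h1
  have hr := T.row_le_entry h1
  have h3 := (h.rothe_iff (f r) (f r + c - r)).mpr ⟨r, c, hrc, rfl, by omega⟩
  have h4 := plusAt_lt h3
  have h5 := h.lt_of_rothe _ _ h3
  omega

theorem plusAt_config (h : HasShape q w μ f) (T : FlaggedSetTableau μ f) (i j : ℕ) :
    plusAt (T.config n) i j ↔ T.At i j := by
  constructor
  · rintro ⟨a, ha, rfl, rfl⟩
    exact mem_config.mp ha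
  · intro hT
    obtain ⟨hi, hj, -⟩ := T.lt_of_at h hT
    exact ⟨(⟨i, hi⟩, ⟨j, hj⟩), mem_config.mpr hT, rfl, rfl⟩

theorem config_top (h : HasShape q w μ f) : (top h.strict).config n = rothe w :=
  config_ext fun i j => by rw [plusAt_config h, top_at_iff h]

theorem config_injective (h : HasShape q w μ f) :
    Function.Injective (config n : FlaggedSetTableau μ f → Config n) := fun T U hTU =>
  ext_of_at fun i j => by rw [← plusAt_config h, hTU, plusAt_config h]

theorem exists_config_of_mem_pipe (h : HasShape q w μ f) {P : Config n} (hP : P ∈ Pipe q w) :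
    ∃ T : FlaggedSetTableau μ f, T.config n = P := by
  classical
  rw [mem_pipe] at hP
  induction hP with
  | refl => exact ⟨_, config_top h⟩
  | @tail P P' _ hstep ih =>
    obtain ⟨T, rfl⟩ := ih
    obtain ⟨i, j, h1, h2⟩ := gridMove_of_move hstep.1
    rw [plusAt_config h] at h1
    obtain ⟨r, c, hrc, e⟩ := h1
    have hul := h2.ul
    have hur := h2.ur
    have hll := h2.ll
    rw [plusAt_config h] at hul hur hll
    have hi : i ∉ T.entry r c := fun hi => hul ⟨r, c, hi, by omega⟩
    let S : Finset ℕ := if plusAt P' (i + 1) (j + 1) then insert i (T.entry r c) else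
      (insert i (T.entry r c)).erase (i + 1)
    have hS : ∀ a, a ∈ S ↔ a = i ∨ (a ∈ T.entry r c ∧ (a = i + 1 → plusAt P' (i + 1) (j + 1))) := by
      intro a
      simp only [S]
      split_ifs with hp
      · simp [hp]
      · simp only [Finset.mem_erase, Finset.mem_insert, hp]
        by_cases ha : a = i <;> simp [ha, and_comm]
    obtain ⟨T', hT', hoff⟩ := T.exists_insert_pred (S := S) hrc (by omega) hur hll
      ((hS i).mpr (.inl rfl)) (fun a ha => by
        rcases (hS a).mp ha with rfl | ha
        · exact Finset.mem_insert_self _ _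
        · exact Finset.mem_insert_of_mem ha.1)
    refine ⟨T', config_ext fun a b => ?_⟩
    rw [plusAt_config h, at_iff_of_update hoff, hT', hS]
    by_cases c1 : a = i ∧ b = j
    · obtain ⟨rfl, rfl⟩ := c1
      have := h2.ul'
      have e' : a + c = b + r := by omega
      simp [this, e']
    by_cases c2 : a = i + 1 ∧ b = j + 1
    · obtain ⟨rfl, rfl⟩ := c2
      simp [hrc, e]
    rw [h2.off a b c1 c2, plusAt_config h]
    by_cases hd : a + c = b + r
    · have n1 : a ≠ i := by omega
      have n2 : a ≠ i + 1 := by omega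
      have h3 : a ∈ T.entry r c → T.At a b := fun ha => ⟨r, c, ha, hd⟩
      simp only [n1, n2, hd]
      tauto
    · simp [hd]

theorem config_mem_pipe (h : HasShape q w μ f) (T : FlaggedSetTableau μ f) :
    T.config n ∈ Pipe q w := by
  classical
  induction hm : ∑ x ∈ μ.cells, ∑ v ∈ T.entry x.1 x.2, (n - v) using Nat.strong_induction_on
    generalizing T with
  | _ m ih =>
  by_cases hT : T = top h.strict
  · rw [hT, config_top h, mem_pipe]
  obtain ⟨r, c, v, hv, hvf, hrow, hcol⟩ := exists_raise h.strict T hT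
  have hrc := T.mem_shape hv
  have hrow' : ∀ r' c' a, r < r' → a ∈ T.entry r' c' → v + 1 < a := fun r' c' a hr ha => by
    have := h.strict r r' hr (μ.up_left_mem le_rfl (Nat.zero_le _) (T.mem_shape ha))
    rw [hrow r' c' a hr ha]; omega
  have hrv := T.row_le_entry hv
  obtain ⟨j, hj⟩ : ∃ j, v + c = j + r := ⟨v + c - r, by omega⟩
  set S := insert (v + 1) ((T.entry r c).erase v) with hS
  have hmemS : ∀ b, b ∈ S ↔ b = v + 1 ∨ (b ≠ v ∧ b ∈ T.entry r c) := fun b => by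
    simp [hS]
  obtain ⟨T', hT', hoff⟩ : ∃ T' : FlaggedSetTableau μ f, T'.entry r c = S ∧
      ∀ a b, ¬ (a = r ∧ b = c) → T'.entry a b = T.entry a b := by
    refine ⟨T.update r c S hrc ⟨v + 1, Finset.mem_insert_self _ _⟩ ?_ ?_ ?_ ?_ ?_,
      if_pos ⟨rfl, rfl⟩, fun a b hab => if_neg hab⟩
    · intro k hk a ha b hb
      rcases (hmemS b).mp hb with rfl | ⟨-, hb⟩
      · exact (T.row_le hk ha hv).trans (Nat.le_succ v)
      · exact T.row_le hk ha hb
    · intro k hk a ha b hb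
      rcases (hmemS b).mp hb with rfl | ⟨-, hb⟩
      · rw [hcol k a hk ha]; omega
      · exact T.row_le hk hb ha
    · intro k hk a ha b hb
      rcases (hmemS b).mp hb with rfl | ⟨-, hb⟩
      · exact (T.col_lt hk ha hv).trans (Nat.lt_succ_self v)
      · exact T.col_lt hk ha hb
    · intro k hk a ha b hb
      rcases (hmemS b).mp hb with rfl | ⟨-, hb⟩
      · exact hrow' k c a hk ha
      · exact T.col_lt hk hb ha
    · intro b hb
      rcases (hmemS b).mp hb with rfl | ⟨-, hb⟩
      · omega
      · exact T.flagged r c b hb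
  have hfwd := at_iff_of_update hoff
  have hbwd := at_iff_of_update (T := T') (T' := T) fun a b hab => (hoff a b hab).symm
  rw [hT'] at hfwd hbwd
  have hlr : T'.At (v + 1) (j + 1) := ⟨r, c, by rw [hT', hmemS]; exact .inl rfl, by omega⟩
  obtain ⟨hvn, hjn, -⟩ := T'.lt_of_at h hlr
  have hul : ¬ T'.At v j := by
    rw [hfwd, hmemS]
    simp [hv, hj]
  have hur : ¬ T'.At v (j + 1) := by
    rw [hfwd, hmemS]
    rintro (⟨-, h1⟩ | ⟨⟨r', c', h1, h2⟩, -⟩)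
    · omega
    · rcases lt_trichotomy r' r with hr | rfl | hr
      · exact absurd (T.lt_of_northwest hr (by omega) h1 hv) (lt_irrefl v)
      · have := hcol c' v (by omega) h1; omega
      · have := hrow' r' c' v hr h1; omega
  have hll : ¬ T'.At (v + 1) j := by
    rw [hfwd, hmemS]
    rintro (⟨-, h1⟩ | ⟨⟨r', c', h1, h2⟩, -⟩)
    · omega
    · rcases lt_trichotomy r' r with hr | rfl | hr
      · have := T.lt_of_northwest hr (by omega) h1 hv; omega
      · have := T.row_le (show c' < c by omega) h1 hv; omega
      · have := hrow' r' c' _ hr h1; omega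
  rw [← plusAt_config h] at hul hur hll hlr
  have hexc : IsExcitable (T'.config n) ⟨v, by omega⟩ ⟨v + 1, hvn⟩ ⟨j, by omega⟩ ⟨j + 1, hjn⟩ := by
    rw [plusAt_mk (by omega) (by omega)] at hul hur hll hlr
    exact ⟨rfl, rfl, hul, hur, hll, hlr⟩
  have hsame : ∀ a b, ¬ (a = v ∧ b = j) → ¬ (a = v + 1 ∧ b = j + 1) → (T.At a b ↔ T'.At a b) := by
    intro a b n1 n2
    rw [hfwd, hmemS]
    by_cases hd : a + c = b + r
    · have n1' : a ≠ v := by omega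
      have n2' : a ≠ v + 1 := by omega
      have h3 : a ∈ T.entry r c → T.At a b := fun ha => ⟨r, c, ha, hd⟩
      simp only [n2', hd]
      tauto
    · simp [hd]
  have hTvj : T.At v j := ⟨r, c, hv, hj⟩
  have hmove : Move (T'.config n) (T.config n) ∨ KMove (T'.config n) (T.config n) := by
    by_cases hv1 : v + 1 ∈ T.entry r c
    · refine .inr ⟨_, _, _, _, hexc, config_ext fun a b => ?_⟩
      rw [plusAt_insert, plusAt_config h, plusAt_config h]
      by_cases c1 : a = v ∧ b = j
      · simp [c1, hTvj]
      by_cases c2 : a = v + 1 ∧ b = j + 1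
      · obtain ⟨rfl, rfl⟩ := c2
        rw [plusAt_config h] at hlr
        exact ⟨fun _ => .inr hlr, fun _ => ⟨r, c, hv1, by omega⟩⟩
      · simp [c1, hsame a b c1 c2]
    · refine .inl ⟨_, _, _, _, hexc, config_ext fun a b => ?_⟩
      rw [plusAt_insert, plusAt_erase, plusAt_config h, plusAt_config h]
      by_cases c1 : a = v ∧ b = j
      · simp [c1, hTvj]
      by_cases c2 : a = v + 1 ∧ b = j + 1
      · obtain ⟨rfl, rfl⟩ := c2
        rw [hbwd, hmemS]
        have : v + 1 + c = j + 1 + r := by omega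
        simp [hv1, this]
      · simp [c1, c2, hsame a b c1 c2]
  have hlt : ∑ x ∈ μ.cells, ∑ v ∈ T'.entry x.1 x.2, (n - v) < m := by
    rw [← hm]
    refine Finset.sum_lt_sum (fun x hx => ?_) ⟨(r, c), (YoungDiagram.mem_cells _).mpr hrc, ?_⟩
    swap
    · change ∑ v ∈ T'.entry r c, (n - v) < ∑ v ∈ T.entry r c, (n - v)
      rw [hT', hS, ← Finset.add_sum_erase _ _ hv]
      have : ∑ x ∈ insert (v + 1) ((T.entry r c).erase v), (n - x) ≤
          (n - (v + 1)) + ∑ x ∈ (T.entry r c).erase v, (n - x) := by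
        by_cases hi : v + 1 ∈ (T.entry r c).erase v
        · rw [Finset.insert_eq_self.mpr hi]; omega
        · rw [Finset.sum_insert hi]
      omega
    · by_cases hx' : x.1 = r ∧ x.2 = c
      · rw [hx'.1, hx'.2, hT', hS, ← Finset.add_sum_erase _ _ hv]
        have : ∑ x ∈ insert (v + 1) ((T.entry r c).erase v), (n - x) ≤
            (n - (v + 1)) + ∑ x ∈ (T.entry r c).erase v, (n - x) := by
          by_cases hi : v + 1 ∈ (T.entry r c).erase v
          · rw [Finset.insert_eq_self.mpr hi]; omega
          · rw [Finset.sum_insert hi]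
        omega
      · rw [hoff _ _ hx']
  have hpipe := ih _ hlt T' rfl
  rw [mem_pipe] at hpipe ⊢
  refine hpipe.tail ⟨hmove, fun a ha => ?_⟩
  exact (T.lt_of_at h ((plusAt_config h T _ _).mp ⟨a, ha, rfl, rfl⟩)).2.2

@[to_additive]
theorem prod_config {M : Type*} [CommMonoid M] (h : HasShape q w μ f) (T : FlaggedSetTableau μ f)
    (F : ℕ → ℕ → M) :
    ∏ a ∈ T.config n, F a.1 a.2 =
      ∏ x ∈ μ.cells, ∏ v ∈ T.entry x.1 x.2, F v (v + x.2 - x.1) := by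
  rw [Finset.prod_sigma']
  have hAt : ∀ x : (_ : ℕ × ℕ) × ℕ, x ∈ μ.cells.sigma (fun x => T.entry x.1 x.2) →
      T.At x.2 (x.2 + x.1.2 - x.1.1) := fun x hx => by
    have hv := (Finset.mem_sigma.mp hx).2
    have := T.row_le_entry hv
    exact ⟨x.1.1, x.1.2, hv, by omega⟩
  symm
  refine Finset.prod_bij (fun x hx => (⟨x.2, (T.lt_of_at h (hAt x hx)).1⟩,
    ⟨x.2 + x.1.2 - x.1.1, (T.lt_of_at h (hAt x hx)).2.1⟩)) (fun x hx => ?_) (fun x hx x' hx' e => ?_)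
    (fun a ha => ?_) (fun x hx => rfl)
  · exact mem_config.mpr (hAt x hx)
  · obtain ⟨⟨r, c⟩, v⟩ := x
    obtain ⟨⟨r', c'⟩, v'⟩ := x'
    simp only [Prod.mk.injEq, Fin.mk.injEq] at e
    obtain ⟨rfl, e⟩ := e
    have hv := (Finset.mem_sigma.mp hx).2
    have hv' := (Finset.mem_sigma.mp hx').2
    have h1 := T.row_le_entry hv
    have h2 := T.row_le_entry hv'
    simp only at h1 h2 e
    have hd : c + r' = c' + r := by omega
    obtain ⟨rfl, rfl⟩ := T.eq_of_diagonal hd hv hv'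
    rfl
  · obtain ⟨r, c, h1, h2⟩ := mem_config.mp ha
    refine ⟨⟨(r, c), a.1⟩, Finset.mem_sigma.mpr
      ⟨(YoungDiagram.mem_cells _).mpr (T.mem_shape h1), h1⟩, ?_⟩
    refine Prod.ext rfl (Fin.ext ?_)
    simp only
    omega

theorem card_config (h : HasShape q w μ f) (T : FlaggedSetTableau μ f) :
    (T.config n).card = ∑ x ∈ μ.cells, (T.entry x.1 x.2).card := by
  rw [Finset.card_eq_sum_ones, T.sum_config h fun _ _ => 1]
  simp

theorem card_rothe_eq (h : HasShape q w μ f) : (rothe w).card = μ.card := by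
  rw [← config_top h, card_config h, YoungDiagram.card, Finset.card_eq_sum_ones]
  refine Finset.sum_congr rfl fun x hx => Finset.card_eq_one.mpr ⟨f x.1, ?_⟩
  exact if_pos ((YoungDiagram.mem_cells x).mp hx)

theorem betaWeight_config (h : HasShape q w μ f) (T : FlaggedSetTableau μ f) :
    ClanSchubert.betaWeight w (T.config n) = T.betaWeight := by
  rw [ClanSchubert.betaWeight, betaWeight, card_config h, card_rothe_eq h,
    T.prod_config h fun i j => x i - y j + β * x i * y j]

end FlaggedSetTableau

namespace FlaggedTableau

variable {μ : YoungDiagram} {f : ℕ → ℕ} {n q : ℕ} {w : Perm (Fin n)}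

/-- A tableau as a set-valued tableau. -/
def toSet (U : FlaggedTableau μ f) : FlaggedSetTableau μ f where
  entry i j := if (i, j) ∈ μ then {U.1 i j} else ∅
  entry_eq_empty i j h := if_neg h
  entry_nonempty i j h := by rw [if_pos h]; exact Finset.singleton_nonempty _
  row_weak i j₁ j₂ h a ha b hb := by
    split_ifs at ha hb with h1 h2
    · rw [Finset.mem_singleton] at ha hb
      rw [ha, hb]
      exact U.1.row_weak h h2
    all_goals simp_all
  col_strict i₁ i₂ j h a ha b hb := by
    split_ifs at ha hb with h1 h2
    · rw [Finset.mem_singleton] at ha hb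
      rw [ha, hb]
      exact U.1.col_strict h h2
    all_goals simp_all
  flagged i j a ha := by
    split_ifs at ha with h1
    · rw [Finset.mem_singleton] at ha
      rw [ha]
      exact U.2 i j h1
    · simp at ha

theorem toSet_entry (U : FlaggedTableau μ f) {i j : ℕ} (h : (i, j) ∈ μ) :
    U.toSet.entry i j = {U.1 i j} := if_pos h

theorem toSet_injective : Function.Injective (toSet : FlaggedTableau μ f → _) := by
  intro U V h
  refine Subtype.ext (SemistandardYoungTableau.ext fun i j => ?_)
  by_cases hij : (i, j) ∈ μ
  · have := U.toSet_entry hij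
    rw [h, V.toSet_entry hij, Finset.singleton_inj] at this
    exact this.symm
  · rw [U.1.zeros hij, V.1.zeros hij]

theorem exists_toSet_eq (T : FlaggedSetTableau μ f)
    (hT : ∀ i j, (i, j) ∈ μ → (T.entry i j).card = 1) : ∃ U : FlaggedTableau μ f, U.toSet = T := by
  choose! g hg using fun i j (h : (i, j) ∈ μ) => Finset.card_eq_one.mp (hT i j h)
  have hg' : ∀ i j, (i, j) ∈ μ → g i j ∈ T.entry i j := fun i j h => by rw [hg i j h]; simp
  let U : SemistandardYoungTableau μ :=
    { entry := fun i j => if (i, j) ∈ μ then g i j else 0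
      row_weak' := fun {i j₁ j₂} h hmem => by
        have h1 : (i, j₁) ∈ μ := μ.up_left_mem le_rfl h.le hmem
        rw [if_pos hmem, if_pos h1]
        exact T.row_le h (hg' _ _ h1) (hg' _ _ hmem)
      col_strict' := fun {i₁ i₂ j} h hmem => by
        have h1 : (i₁, j) ∈ μ := μ.up_left_mem h.le le_rfl hmem
        rw [if_pos hmem, if_pos h1]
        exact T.col_lt h (hg' _ _ h1) (hg' _ _ hmem)
      zeros' := fun h => if_neg h }
  have hU : ∀ i j, (i, j) ∈ μ → U i j = g i j := fun i j h => if_pos h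
  let U' : FlaggedTableau μ f :=
    ⟨U, fun i j h => by rw [hU i j h]; exact T.flagged i j _ (hg' i j h)⟩
  refine ⟨U', FlaggedSetTableau.ext (funext fun i => funext fun j => ?_)⟩
  · by_cases h : (i, j) ∈ μ
    · rw [toSet_entry U' h, hg i j h, ← hU i j h]
    · rw [FlaggedSetTableau.entry_eq_empty _ i j h, T.entry_eq_empty i j h]

theorem card_config_toSet (h : HasShape q w μ f) (U : FlaggedTableau μ f) :
    (U.toSet.config n).card = (rothe w).card := by
  rw [FlaggedSetTableau.card_config h, FlaggedSetTableau.card_rothe_eq h, YoungDiagram.card,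
    Finset.card_eq_sum_ones]
  refine Finset.sum_congr rfl fun x hx => ?_
  rw [U.toSet_entry ((YoungDiagram.mem_cells x).mp hx), Finset.card_singleton]

theorem weight_config (h : HasShape q w μ f) (U : FlaggedTableau μ f) :
    ClanSchubert.weight (U.toSet.config n) = U.weight := by
  rw [ClanSchubert.weight, weight, U.toSet.prod_config h fun i j =>
    (MvPolynomial.X (Sum.inl i) - MvPolynomial.X (Sum.inr j) : MvPolynomial (ℕ ⊕ ℕ) ℤ)]
  refine Finset.prod_congr rfl fun x hx => ?_
  rw [U.toSet_entry ((YoungDiagram.mem_cells x).mp hx), Finset.prod_singleton]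

end FlaggedTableau

namespace HasShape

variable {μ : YoungDiagram} {f : ℕ → ℕ} {n q : ℕ} {w : Perm (Fin n)}

theorem exists_pipe_equiv (h : HasShape q w μ f) :
    ∃ e : Pipe q w ≃ FlaggedSetTableau μ f, ∀ P, (e P).betaWeight = betaWeight w P.1 := by
  let e : FlaggedSetTableau μ f ≃ Pipe q w :=
    Equiv.ofBijective (fun T => ⟨T.config n, T.config_mem_pipe h⟩)
      ⟨fun T U hTU => FlaggedSetTableau.config_injective h (Subtype.ext_iff.mp hTU), fun P => by
        obtain ⟨T, hT⟩ := FlaggedSetTableau.exists_config_of_mem_pipe h P.2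
        exact ⟨T, Subtype.ext hT⟩⟩
  refine ⟨e.symm, fun P => ?_⟩
  obtain ⟨T, rfl⟩ := e.surjective P
  rw [e.symm_apply_apply]
  exact (T.betaWeight_config h).symm

theorem exists_reducedPipe_equiv (h : HasShape q w μ f) :
    ∃ e : ReducedPipe q w ≃ FlaggedTableau μ f, ∀ P, (e P).weight = weight P.1 := by
  let e : FlaggedTableau μ f ≃ ReducedPipe q w :=
    Equiv.ofBijective (fun U => ⟨U.toSet.config n, mem_reducedPipe_iff_card.mpr
        ⟨U.toSet.config_mem_pipe h, U.card_config_toSet h⟩⟩)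
      ⟨fun T U hTU => FlaggedTableau.toSet_injective
        (FlaggedSetTableau.config_injective h (Subtype.ext_iff.mp hTU)), fun P => by
        obtain ⟨hP, hcard⟩ := mem_reducedPipe_iff_card.mp P.2
        obtain ⟨T, hT⟩ := FlaggedSetTableau.exists_config_of_mem_pipe h hP
        rw [← hT, FlaggedSetTableau.card_config h, FlaggedSetTableau.card_rothe_eq h,
          YoungDiagram.card, Finset.card_eq_sum_ones] at hcard
        have hle : ∀ x ∈ μ.cells, 1 ≤ (T.entry x.1 x.2).card := fun x hx =>
          Finset.card_pos.mpr (T.entry_nonempty _ _ ((YoungDiagram.mem_cells x).mp hx))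
        have hall := (Finset.sum_eq_sum_iff_of_le hle).mp hcard.symm
        obtain ⟨U, rfl⟩ := FlaggedTableau.exists_toSet_eq T fun i j hij =>
          (hall (i, j) ((YoungDiagram.mem_cells _).mpr hij)).symm
        exact ⟨U, Subtype.ext hT⟩⟩
  refine ⟨e.symm, fun P => ?_⟩
  obtain ⟨T, rfl⟩ := e.surjective P
  rw [e.symm_apply_apply]
  exact (T.weight_config h).symm

theorem singleSchubert_eq (h : HasShape q w μ f)
    (hw : doubleSchubert w = ∑ P ∈ ReducedPipe q w, weight P) :
    singleSchubert w = flaggedSchur μ f := by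
  obtain ⟨e, he⟩ := h.exists_reducedPipe_equiv
  rw [singleSchubert, hw, ← Finset.sum_coe_sort, ← e.symm.sum_comp, map_sum, flaggedSchur]
  refine Finset.sum_congr rfl fun T _ => ?_
  rw [← he, e.apply_symm_apply, FlaggedTableau.weight, map_prod]
  refine Finset.prod_congr rfl fun c _ => ?_
  simp

end HasShape

/-! ### The shape and the flagging of a matchless clan -/

namespace Clan

variable {n p q : ℕ}

theorem card_filter_orderEmbOfFin (B : Finset (Fin n)) (r : Fin B.card) :
    (B.filter (· < B.orderEmbOfFin rfl r)).card = r := by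
  have : B.filter (· < B.orderEmbOfFin rfl r) =
      (Finset.Iio r).map (B.orderEmbOfFin rfl).toEmbedding := by
    ext k
    simp only [Finset.mem_filter, Finset.mem_map, Finset.mem_Iio]
    constructor
    · rintro ⟨hk, hlt⟩
      have : k ∈ Set.range (B.orderEmbOfFin rfl) := by rw [B.range_orderEmbOfFin]; exact hk
      obtain ⟨s, rfl⟩ := this
      exact ⟨s, (B.orderEmbOfFin rfl).lt_iff_lt.mp hlt, rfl⟩
    · rintro ⟨s, hs, rfl⟩
      exact ⟨B.orderEmbOfFin_mem rfl s, (B.orderEmbOfFin rfl).lt_iff_lt.mpr hs⟩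
  rw [this, Finset.card_map, Fin.card_Iio]

theorem hasShape_of_matchless (τ : Clan n p q) (h1 : τ.plus = τ.minusᶜ) (h2 : τ.minus.card = q) :
    HasShape q (shuffle τ.minus) τ.plusShape τ.plusFlag := by
  have hmem : ∀ r c, (r, c) ∈ τ.plusShape ↔ (r < τ.plus.card ∧ c < q) ∧
      c < q - countBelow (memVal τ.minus) (τ.plusFlag r) := fun r c => by
    rw [countBelow_memVal, ← YoungDiagram.mem_cells, plusShape]
    simp only [Finset.mem_filter, Finset.mem_product, Finset.mem_range]
  have hflag : ∀ r (h : r < τ.plus.card), τ.plusFlag r = τ.plus.orderEmbOfFin rfl ⟨r, h⟩ :=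
    fun r h => dif_pos h
  have hcount : ∀ r, r < τ.plus.card →
      countBelow (memVal τ.minus) (τ.plusFlag r) + r = τ.plusFlag r := by
    intro r h
    rw [countBelow_memVal, hflag r h]
    have e1 := card_filter_orderEmbOfFin τ.plus ⟨r, h⟩
    generalize τ.plus.orderEmbOfFin rfl ⟨r, h⟩ = k at *
    have e2 : (τ.minus.filter fun a : Fin n => (a : ℕ) < k).card + (τ.plus.filter (· < k)).card =
        (Finset.univ.filter (· < k)).card := by
      rw [← Finset.card_union_of_disjoint]
      · congr 1
        ext a
        simp only [h1, Finset.mem_union, Finset.mem_filter, Finset.mem_compl, Finset.mem_univ,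
          Fin.lt_def]
        tauto
      · rw [Finset.disjoint_left]
        intro a ha hb
        rw [h1] at hb
        exact Finset.mem_compl.mp (Finset.mem_filter.mp hb).1 (Finset.mem_filter.mp ha).1
    have e3 : (Finset.univ.filter (· < k)).card = (k : ℕ) := by
      rw [Finset.filter_gt_eq_Iio, Fin.card_Iio]
    simp only at e1
    omega
  refine ⟨fun r s hrs hs => ?_, fun i j => ?_, fun i j h => ?_⟩
  · have hs' := ((hmem s 0).mp hs).1.1
    rw [hflag s hs', hflag r (hrs.trans hs')]
    exact (τ.plus.orderEmbOfFin rfl).strictMono (show (⟨r, _⟩ : Fin τ.plus.card) < ⟨s, hs'⟩ from hrs)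
  · rw [plusAt_rothe_shuffle, h2, gridRothe]
    constructor
    · rintro ⟨hi, hj, hA, hle⟩
      have hip : (⟨i, hi⟩ : Fin n) ∈ τ.plus := by
        rw [h1, Finset.mem_compl, ← memVal_val]; exact hA
      have : (⟨i, hi⟩ : Fin n) ∈ Set.range (τ.plus.orderEmbOfFin rfl) := by
        rw [τ.plus.range_orderEmbOfFin]; exact hip
      obtain ⟨⟨r, hr⟩, e⟩ := this
      have hfr : τ.plusFlag r = i := by rw [hflag r hr, e]
      have := hcount r hr
      rw [hfr] at this
      refine ⟨r, j - countBelow (memVal τ.minus) i, ?_, hfr.symm, by omega⟩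
      rw [hmem, hfr]
      refine ⟨⟨hr, ?_⟩, ?_⟩ <;> omega
    · rintro ⟨r, c, hrc, rfl, e⟩
      obtain ⟨⟨hr, hc⟩, hc'⟩ := (hmem r c).mp hrc
      have hcr := hcount r hr
      have hlt : τ.plusFlag r < n := by rw [hflag r hr]; exact Fin.is_lt _
      refine ⟨hlt, by omega, ?_, by omega⟩
      rw [hflag r hr, memVal_val]
      have := τ.plus.orderEmbOfFin_mem rfl ⟨r, hr⟩
      exact Finset.mem_compl.mp (h1.subset this)
  · rw [plusAt_rothe_shuffle, h2] at h
    exact h.2.1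

theorem hasShape_u (γ : Clan n p q) : HasShape q γ.u γ.shape γ.flag := by
  refine γ.tauMinus.hasShape_of_matchless ?_ γ.card_minus_union_left
  ext i
  have := γ.mem_cases i
  simp only [tauMinus, Finset.mem_union, Finset.mem_compl]
  tauto

theorem hasShape_v (γ : Clan n p q) : HasShape p γ.v γ.shapeHat γ.flagHat := by
  refine γ.tauPlus.flip.hasShape_of_matchless ?_ γ.card_plus_union_left
  ext i
  have := γ.mem_cases i
  simp only [tauPlus, flip, Finset.mem_union, Finset.mem_compl]
  tauto

end Clan

end ClanSchubert

end

theorem mainTheorem11 {n p q : ℕ} (γ : ClanSchubert.Clan n p q) (hγ : γ.NonCrossing) :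
    -- the β-double Schubert polynomials are sums over pipe diagrams
    (ClanSchubert.betaSchubert γ.u =
        ∑ P ∈ ClanSchubert.Pipe q γ.u, ClanSchubert.betaWeight γ.u P) ∧
    (ClanSchubert.betaSchubert γ.v =
        ∑ P ∈ ClanSchubert.Pipe p γ.v, ClanSchubert.betaWeight γ.v P) ∧
    -- weight-preserving bijections with flagged set-valued tableaux
    (∃ e : ClanSchubert.Pipe q γ.u ≃ ClanSchubert.FlaggedSetTableau γ.shape γ.flag,
        ∀ P, (e P).betaWeight = ClanSchubert.betaWeight γ.u P.1) ∧
    (∃ e : ClanSchubert.Pipe p γ.v ≃ ClanSchubert.FlaggedSetTableau γ.shapeHat γ.flagHat,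
        ∀ P, (e P).betaWeight = ClanSchubert.betaWeight γ.v P.1) ∧
    -- the same at `β = 0`, with reduced pipe diagrams and ordinary flagged tableaux
    (ClanSchubert.doubleSchubert γ.u =
        ∑ P ∈ ClanSchubert.ReducedPipe q γ.u, ClanSchubert.weight P) ∧
    (ClanSchubert.doubleSchubert γ.v =
        ∑ P ∈ ClanSchubert.ReducedPipe p γ.v, ClanSchubert.weight P) ∧
    (∃ e : ClanSchubert.ReducedPipe q γ.u ≃ ClanSchubert.FlaggedTableau γ.shape γ.flag,
        ∀ P, (e P).weight = ClanSchubert.weight P.1) ∧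
    (∃ e : ClanSchubert.ReducedPipe p γ.v ≃ ClanSchubert.FlaggedTableau γ.shapeHat γ.flagHat,
        ∀ P, (e P).weight = ClanSchubert.weight P.1) ∧
    -- the single Schubert polynomials are flagged Schur polynomials
    (ClanSchubert.singleSchubert γ.u = ClanSchubert.flaggedSchur γ.shape γ.flag) ∧
    (ClanSchubert.singleSchubert γ.v = ClanSchubert.flaggedSchur γ.shapeHat γ.flagHat) := by
  have hu := γ.hasShape_u
  have hv := γ.hasShape_v
  have du := ClanSchubert.doubleSchubert_shuffle _ γ.card_minus_union_left
  have dv := ClanSchubert.doubleSchubert_shuffle _ γ.card_plus_union_left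
  exact ⟨ClanSchubert.betaSchubert_shuffle _ γ.card_minus_union_left,
    ClanSchubert.betaSchubert_shuffle _ γ.card_plus_union_left,
    hu.exists_pipe_equiv, hv.exists_pipe_equiv, du, dv,
    hu.exists_reducedPipe_equiv, hv.exists_reducedPipe_equiv,
    hu.singleSchubert_eq du, hv.singleSchubert_eq dv⟩
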